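/- For $\lambda>0$, irrational $\alpha\in(0,1)$ and $\theta\in[0,1)$ let $v_{\alpha,\theta}(n)=\chi_{[1-\alpha,1)}(n\alpha+\theta \bmod 1)$, $n\in\mathbb Z$, and let $H_{\lambda,\alpha,\theta}$ be the operator on $\ell^2(\mathbb Z)$ given by $(H_{\lambda,\alpha,\theta}u)(n)=u(n+1)+u(n-1)+\lambda v_{\alpha,\theta}(n)u(n)$. Its spectrum does not depend on $\theta$; denote it by $\Sigma_{\lambda,\alpha}\subset\mathbb R$ (so $\Sigma_{\lambda,\alpha}=\bigcup_{\theta\in[0,1)}\sigma(H_{\lambda,\alpha,\theta})$). Put $$T(E,m,\lambda,\alpha,\theta)=\begin{pmatrix}E-\lambda v_{\alpha,\theta}(m)&-1\\1&0\end{pmatrix},$$ and let $M(E,n,\lambda,\alpha,\theta)$ be $T(E,n,\lambda,\alpha,\theta)\cdots T(E,1,\lambda,\alpha,\theta)$ for $n\ge1$, the identity for $n=0$, and $T(E,n+1,\lambda,\alpha,\theta)^{-1}\cdots T(E,0,\lambda,\alpha,\theta)^{-1}$ for $n\le-1$. With $\|\cdot\|$ the operator norm of a matrix (for the Euclidean norm),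 define for $L\ge1$ $$\|M(E,\lambda,\alpha,\theta)\|_L^2=\sum_{n=1}^{\lfloor L\rfloor-1}\|M(E,n,\lambda,\alpha,\theta)\|^2+(L-\lfloor L\rfloor)\,\|M(E,\lfloor L\rfloor,\lambda,\alpha,\theta)\|^2,$$ and for $L\le-1$ define $\|M(E,\lambda,\alpha,\theta)\|_L^2$ by the same expression with $|L|$ in place of $L$ and $M(E,-n,\lambda,\alpha,\theta)$ in place of $M(E,n,\lambda,\alpha,\theta)$. Let $q_k$ be the denominators of the continued fraction convergents of $\alpha=[0;a_1,a_2,\dots]$ ($q_0=1$, $q_1=a_1$, $q_k=a_kq_{k-1}+q_{k-2}$), and let $\mathcal E$ be the set of irrational $\alpha\in(0,1)$ for which there is a real number $B$ with $$q_k+1\le B^k\quad\text{for all }k\ge1.\tag{1}$$ Finally let $\xi(\lambda)=\left(\frac{\lambda-8}{3}\right)^{1/2}$. **Proposition.** Let $\lambda>20$ and $\alpha\in\mathcal E$. Then there are constants $C,\zeta>0$ such that for every $\theta\in[0,1)$ there is $L_0(\theta)$ such that for every $E\in\Sigma_{\lambda,\alpha}$, $$\|M(E,\lambda,\alpha,\theta)\|_L\ge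 C|L|^{\zeta}\quad\text{for all real } L\text{ with }|L|\ge L_0(\theta).\tag{2}$$ Moreover, for every $B$ satisfying (1), the number $\frac{\log\xi(\lambda)}{3\log B}$ is positive, and for every $\zeta$ with $0<\zeta\le\frac{\log\xi(\lambda)}{3\log B}$ there is a constant $C>0$ such that (2) holds with these $C,\zeta$ for every $\theta\in[0,1)$ and every $E\in\Sigma_{\lambda,\alpha}$, with a suitable $L_0(\theta)$ not depending on $E$. -/

import Mathlib

open scoped ENNReal lp

noncomputable section

namespace Sturmian

/-- `q α k` is the denominator `q_k` of the `k`-th continued fraction convergent of `α`;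
for irrational `α = [0; a₁, a₂, …]` in `(0,1)` one has
`q_0 = 1`, `q_1 = a₁`, `q_k = a_k q_{k-1} + q_{k-2}`. -/
def q (α : ℝ) (k : ℕ) : ℝ := (GenContFract.of α).dens k

/-- `q_k + 1 ≤ B ^ k` for every `k = 1, 2, 3, …`. -/
def IsGrowthBound (α B : ℝ) : Prop := ∀ k : ℕ, 1 ≤ k → q α k + 1 ≤ B ^ k

/-- The set `𝓔` of irrational rotation numbers in `(0,1)` with exponentially bounded `q_k`. -/
def classE : Set ℝ := {α | α ∈ Set.Ioo (0 : ℝ) 1 ∧ Irrational α ∧ ∃ B : ℝ, IsGrowthBound α B}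

/-- The Sturmian sequence `v_{α,θ}(n) = χ_{[1-α,1)}(nα + θ mod 1)`. -/
def v (α θ : ℝ) (n : ℤ) : ℝ :=
  Set.indicator (Set.Ico (1 - α) 1) (fun _ => (1 : ℝ)) (Int.fract ((n : ℝ) * α + θ))

theorem abs_v_le_one (α θ : ℝ) (n : ℤ) : |v α θ n| ≤ 1 := by
  unfold v Set.indicator
  split_ifs <;> simp

/-- Reindexing by a permutation of `ℤ` as an isometry of `ℓ²(ℤ)`: `u ↦ u ∘ e`. -/
def reindex (e : ℤ ≃ ℤ) : ℓ²(ℤ, ℂ) →L[ℂ] ℓ²(ℤ, ℂ) :=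
  LinearMap.mkContinuous
    { toFun := fun u => ⟨fun n => u (e n), memℓp_gen
        (((lp.memℓp u).summable (by norm_num)).comp_injective e.injective)⟩
      map_add' := fun _ _ => rfl
      map_smul' := fun _ _ => rfl } 1 (fun u => by
    rw [one_mul]
    refine lp.norm_le_of_tsum_le (by norm_num) (norm_nonneg _) ?_
    rw [lp.norm_rpow_eq_tsum (by norm_num) u]
    exact (e.tsum_eq (fun n => ‖u n‖ ^ (2 : ℝ≥0∞).toReal)).le)

/-- Multiplication by the bounded sequence `v_{α,θ}` on `ℓ²(ℤ)`. -/
def potential (α θ : ℝ) : ℓ²(ℤ, ℂ) →L[ℂ] ℓ²(ℤ, ℂ) :=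
  lp.mapCLM 2 (fun n : ℤ => ((v α θ n : ℝ) : ℂ) • ContinuousLinearMap.id ℂ ℂ)
    (K := 1) zero_le_one (fun n => by
      rw [norm_smul, Complex.norm_real]
      simpa using abs_v_le_one α θ n)

/-- The discrete Schrödinger operator
`(H_{λ,α,θ} u)(n) = u(n+1) + u(n-1) + λ v_{α,θ}(n) u(n)` on `ℓ²(ℤ)`. -/
def H (lam α θ : ℝ) : ℓ²(ℤ, ℂ) →L[ℂ] ℓ²(ℤ, ℂ) :=
  reindex (Equiv.addRight 1) + reindex (Equiv.subRight 1) + (lam : ℂ) • potential α θ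

theorem H_apply (lam α θ : ℝ) (u : ℓ²(ℤ, ℂ)) (n : ℤ) :
    H lam α θ u n = u (n + 1) + u (n - 1) + (lam : ℂ) * (v α θ n : ℂ) * u n := by
  rw [mul_assoc]
  rfl

/-- The spectrum `Σ_{λ,α}`, as a set of real energies.  For irrational `α` the spectrum of
`H_{λ,α,θ}` does not depend on the phase `θ ∈ [0,1)`, so this union is the common spectrum. -/
def Sigma (lam α : ℝ) : Set ℝ :=
  {E | ∃ θ ∈ Set.Ico (0 : ℝ) 1, (E : ℂ) ∈ spectrum ℂ (H lam α θ)}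

/-- The one-step transfer matrix `T(E,m,λ,α,θ)`. -/
def T (E : ℝ) (m : ℤ) (lam α θ : ℝ) : Matrix (Fin 2) (Fin 2) ℝ :=
  !![E - lam * v α θ m, -1; 1, 0]

/-- `T(n) ⋯ T(1)`. -/
def Mpos (E lam α θ : ℝ) : ℕ → Matrix (Fin 2) (Fin 2) ℝ
  | 0 => 1
  | n + 1 => T E ((n : ℤ) + 1) lam α θ * Mpos E lam α θ n

/-- `T(-n+1)⁻¹ ⋯ T(0)⁻¹`. -/
def Mneg (E lam α θ : ℝ) : ℕ → Matrix (Fin 2) (Fin 2) ℝ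
  | 0 => 1
  | n + 1 => (T E (-(n : ℤ)) lam α θ)⁻¹ * Mneg E lam α θ n

/-- The transfer matrix `M(E,n,λ,α,θ)`, `n ∈ ℤ`. -/
def M (E : ℝ) (n : ℤ) (lam α θ : ℝ) : Matrix (Fin 2) (Fin 2) ℝ :=
  if 0 ≤ n then Mpos E lam α θ n.toNat else Mneg E lam α θ (-n).toNat

/-- The operator norm of a matrix acting on Euclidean space. -/
def opNorm (A : Matrix (Fin 2) (Fin 2) ℝ) : ℝ := ‖Matrix.toEuclideanCLM (𝕜 := ℝ) A‖

/-- The averaged transfer-matrix norm `‖M(E,λ,α,θ)‖_L`: for `L ≥ 1`,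
`‖M‖_L² = ∑_{n=1}^{⌊L⌋-1} ‖M(n)‖² + (L - ⌊L⌋) ‖M(⌊L⌋)‖²`, and for `L ≤ 0` the same expression
with `|L|` in place of `L` and `M(-n)` in place of `M(n)`. -/
def avgNorm (E lam α θ L : ℝ) : ℝ :=
  let s : ℤ := if 0 ≤ L then 1 else -1
  Real.sqrt
    (∑ n ∈ Finset.Icc 1 (⌊|L|⌋₊ - 1), opNorm (M E (s * (n : ℤ)) lam α θ) ^ 2
      + (|L| - (⌊|L|⌋₊ : ℝ)) * opNorm (M E (s * (⌊|L|⌋₊ : ℤ)) lam α θ) ^ 2)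

/-- `ξ(λ) = ((λ - 8) / 3)^{1/2}`. -/
def xi (lam : ℝ) : ℝ := Real.sqrt ((lam - 8) / 3)

/-- The power-law lower bound with constant `C` and exponent `ζ`: for every phase `θ ∈ [0,1)`
there is a threshold `L₀(θ)`, the same for all energies `E ∈ Σ_{λ,α}`, such that
`‖M(E,λ,α,θ)‖_L ≥ C |L|^ζ` whenever `|L| ≥ L₀(θ)`. -/
def PowerLawBound (lam α C ζ : ℝ) : Prop :=
  ∀ θ ∈ Set.Ico (0 : ℝ) 1, ∃ L₀ : ℝ, ∀ E ∈ Sigma lam α, ∀ L : ℝ, L₀ ≤ |L| →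
    C * |L| ^ ζ ≤ avgNorm E lam α θ L

end Sturmian

end

/-! The transfer matrices are compared with the derivatives, with respect to the energy, of the
traces `x_k(E)` of the transfer matrices over the Christoffel words of the convergents of `α`. Three
facts combine.

Leibniz: differentiating a product of `q` step matrices of determinant 1 gives a sum of terms `A_q
A_{l+1}⁻¹ P A_l`, so the derivative of its trace is at most a constant times `‖A_q‖ ∑ ‖A_{l+1}‖
‖A_l‖`, hence at most a constant times `‖M‖_L ^ 3` once `L ≥ q + 2` (`abs_derivative_le_avgNorm`).
Every phase sees `x_k` itself on a window of length `q_k`, after a shift of at most one site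
(`exists_windowTrace`), so the bound holds for all phases and in both directions.

Spectrum: the `x_k` follow the trace map and preserve the Fricke-Vogt invariant `λ² + 4`. If two
neighbouring traces along the intermediate convergents exceed 2 in modulus, all later `x_j` do so on
a whole neighbourhood of `E`; that neighbourhood is a common spectral gap of periodic approximants,
hence of `H`. So energies of the spectrum never escape (`noEscape_of_mem_Sigma`).

Expansion: without escape, each level multiplies the derivative by `ξ(λ)` on average
(`BandState.step`). A level whose pivot trace is small gains at least `ξ²` (`elliptic_chain`). A
level whose pivot is large loses nothing (`hyperbolic_step`) and is followed by a level with small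
pivot, whose gain pays for both. Thus `ξ ^ k` is at most `ξ |x_j'|` for `j = k` or `j = k + 1`.

Together `ξ ^ k ≲ ‖M‖_L ^ 3` for `|L|` between `B ^ (k + 3)` and `B ^ (k + 4)`, which is a power law
for every `ζ` with `B ^ (3ζ) ≤ ξ`. -/

namespace Sturmian

noncomputable section

open Polynomial

/-! ### Transfer matrices as polynomials in the energy -/

/-- The one-step transfer matrix as a polynomial in the energy. -/
def stepMat (c : ℝ) : Matrix (Fin 2) (Fin 2) ℝ[X] := !![X - C c, -1; 1, 0]

/-- The transfer matrix over the potential values `w 0, …, w (n - 1)`, as a polynomial in the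
energy. -/
def charMat (w : ℕ → ℝ) : ℕ → Matrix (Fin 2) (Fin 2) ℝ[X]
  | 0 => 1
  | n + 1 => stepMat (w n) * charMat w n

theorem det_stepMat (c : ℝ) : (stepMat c).det = 1 := by
  simp [stepMat, Matrix.det_fin_two]

theorem det_charMat (w : ℕ → ℝ) (n : ℕ) : (charMat w n).det = 1 := by
  induction n with
  | zero => simp [charMat]
  | succ n ih => rw [charMat, Matrix.det_mul, ih, det_stepMat, one_mul]

theorem charMat_congr {w w' : ℕ → ℝ} {n : ℕ} (h : ∀ i < n, w i = w' i) :
    charMat w n = charMat w' n := by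
  induction n with
  | zero => rfl
  | succ n ih =>
    rw [charMat, charMat, h n (Nat.lt_succ_self n), ih fun i hi => h i (hi.trans (Nat.lt_succ_self n))]

theorem charMat_add (w : ℕ → ℝ) (m n : ℕ) :
    charMat w (m + n) = charMat (fun i => w (m + i)) n * charMat w m := by
  induction n with
  | zero => simp [charMat]
  | succ n ih => rw [← add_assoc, charMat, charMat, ih, mul_assoc]

/-- Moving a periodic window by one site conjugates its matrix by a step matrix. -/
theorem trace_charMat_shift {w : ℕ → ℝ} {q : ℕ} (h : ∀ i, w (i + q) = w i) (s : ℕ) :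
    (charMat (fun i => w (s + i)) q).trace = (charMat w q).trace := by
  induction s with
  | zero => simp
  | succ s ih =>
    rw [← ih]
    have h1 : charMat (fun i => w (s + i)) (q + 1)
        = stepMat (w s) * charMat (fun i => w (s + i)) q := by
      rw [charMat, h]
    have h2 : charMat (fun i => w (s + i)) (1 + q)
        = charMat (fun i => w (s + 1 + i)) q * stepMat (w s) := by
      rw [charMat_add]
      simp [charMat, add_assoc]
    rw [add_comm, h2] at h1
    have h3 : stepMat (w s) * (stepMat (w s)).adjugate = 1 := by
      rw [Matrix.mul_adjugate, det_stepMat, one_smul]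
    calc (charMat (fun i => w (s + 1 + i)) q).trace
        = (charMat (fun i => w (s + 1 + i)) q * stepMat (w s) * (stepMat (w s)).adjugate).trace := by
          rw [mul_assoc, h3, mul_one]
      _ = _ := by
          rw [h1, Matrix.trace_mul_comm, ← mul_assoc, Matrix.adjugate_mul, det_stepMat, one_smul,
            one_mul]

/-- The coordinate swap on the plane. -/
def swapMat (R : Type*) [CommRing R] : Matrix (Fin 2) (Fin 2) R := !![0, 1; 1, 0]

theorem swapMat_mul_self (R : Type*) [CommRing R] : swapMat R * swapMat R = 1 := by
  ext i j; fin_cases i <;> fin_cases j <;> simp [swapMat]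

theorem adjugate_stepMat (c : ℝ) :
    (stepMat c).adjugate = swapMat ℝ[X] * stepMat c * swapMat ℝ[X] := by
  rw [Matrix.adjugate_fin_two]
  ext i j : 2; fin_cases i <;> fin_cases j <;> simp [swapMat, stepMat]

theorem charMat_succ' (w : ℕ → ℝ) (n : ℕ) :
    charMat w (n + 1) = charMat (fun i => w (i + 1)) n * stepMat (w 0) := by
  rw [add_comm, charMat_add]
  simp [charMat, add_comm]

theorem adjugate_charMat (w : ℕ → ℝ) (n : ℕ) :
    (charMat w n).adjugate
      = swapMat ℝ[X] * charMat (fun i => w (n - 1 - i)) n * swapMat ℝ[X] := by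
  induction n generalizing w with
  | zero => simp [charMat, swapMat_mul_self]
  | succ n ih =>
    have : charMat (fun i => w (n + 1 - 1 - i)) n = charMat (fun i => w (n - 1 - i + 1)) n := by
      refine charMat_congr fun i _ => ?_
      congr 1; omega
    rw [charMat_succ', charMat, Matrix.adjugate_mul_distrib, ih, adjugate_stepMat, this]
    simp only [add_tsub_cancel_right, tsub_self]
    have h := swapMat_mul_self ℝ[X]
    calc _ = swapMat ℝ[X] * stepMat (w 0) * (swapMat ℝ[X] * swapMat ℝ[X])
          * charMat (fun i => w (n - 1 - i + 1)) n * swapMat ℝ[X] := by simp only [mul_assoc]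
      _ = _ := by rw [h]; simp only [mul_assoc, one_mul]

/-- A 2×2 matrix and its adjugate have the same trace, and inverting a step matrix is the same as
conjugating it by the swap; so inversion reverses the word up to conjugation. This later serves the
left half-line. -/
theorem trace_charMat_reverse (w : ℕ → ℝ) (n : ℕ) :
    (charMat (fun i => w (n - 1 - i)) n).trace = (charMat w n).trace := by
  have h : (charMat w n).adjugate.trace = (charMat w n).trace := by
    rw [Matrix.adjugate_fin_two, Matrix.trace_fin_two, Matrix.trace_fin_two]
    simp [add_comm]
  rw [← h, adjugate_charMat, Matrix.trace_mul_comm, ← mul_assoc, swapMat_mul_self, one_mul]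

/-! ### Christoffel words and the trace recursion -/

/-- The letters of the Christoffel word of slope `p / q`. -/
def christoffel (p : ℤ) (q : ℕ) (i : ℕ) : ℤ := (((i : ℤ) + 1) * p) / q - ((i : ℤ) * p) / q

/-- The transfer matrix over the Christoffel word of slope `p / q`. -/
def christoffelMat (lam : ℝ) (p : ℤ) (q : ℕ) : Matrix (Fin 2) (Fin 2) ℝ[X] :=
  charMat (fun i => lam * (christoffel p q i : ℝ)) q

theorem floor_mediant_left {p p' : ℤ} {q q' : ℕ} (hq : 0 < q) (hq' : 0 < q')
    (h : p' * q - p * q' = 1) {n : ℤ} (h0 : 0 ≤ n) (hn : n ≤ q) :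
    (n * (p + p')) / ((q + q' : ℕ) : ℤ) = (n * p) / (q : ℤ) := by
  have hq1 : (0 : ℤ) < q := by exact_mod_cast hq
  have hq2 : (0 : ℤ) < q' := by exact_mod_cast hq'
  have e1 := Int.emod_add_mul_ediv (n * p) q
  have e2 := Int.emod_nonneg (n * p) hq1.ne'
  have e3 := Int.emod_lt_of_pos (n * p) hq1
  set m := (n * p) / (q : ℤ)
  set r := (n * p) % (q : ℤ)
  have key : (q : ℤ) * (n * (p + p')) = (q + q') * (n * p) + n := by linear_combination n * h
  push_cast
  rw [Int.ediv_eq_iff_of_pos (by positivity)]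
  constructor
  · refine le_of_mul_le_mul_left ?_ hq1
    rw [key, ← e1]; nlinarith [mul_nonneg (add_pos hq1 hq2).le e2]
  · refine lt_of_mul_lt_mul_left ?_ hq1.le
    rw [key, ← e1]
    have : ((q : ℤ) + q') * r ≤ (q + q') * (q - 1) :=
      mul_le_mul_of_nonneg_left (by omega) (by positivity)
    nlinarith

theorem floor_mediant_right {p p' : ℤ} {q q' : ℕ} (hq : 0 < q) (hq' : 0 < q')
    (h : p' * q - p * q' = 1) {n : ℤ} (h0 : 0 ≤ n) (hn : n ≤ q') :
    ((q + n) * (p + p')) / ((q + q' : ℕ) : ℤ) = p + (n * p') / (q' : ℤ) := by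
  have hq1 : (0 : ℤ) < q := by exact_mod_cast hq
  have hq2 : (0 : ℤ) < q' := by exact_mod_cast hq'
  have e1 := Int.emod_add_mul_ediv (n * p') q'
  have e2 := Int.emod_nonneg (n * p') hq2.ne'
  have e3 := Int.emod_lt_of_pos (n * p') hq2
  set m := (n * p') / (q' : ℤ)
  set r := (n * p') % (q' : ℤ)
  have key : (q' : ℤ) * ((q + n) * (p + p')) = (q + q') * (q' * p + n * p') + (q' - n) := by
    linear_combination (q' - n) * h
  push_cast
  rw [Int.ediv_eq_iff_of_pos (by positivity)]
  constructor
  · refine le_of_mul_le_mul_left ?_ hq2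
    rw [key, ← e1]; nlinarith [mul_nonneg (add_pos hq1 hq2).le e2]
  · refine lt_of_mul_lt_mul_left ?_ hq2.le
    rw [key, ← e1]
    have : ((q : ℤ) + q') * r ≤ (q + q') * (q' - 1) :=
      mul_le_mul_of_nonneg_left (by omega) (by positivity)
    nlinarith

/-- Standard factorization: for Farey neighbours `p / q < p' / q'` the word of the mediant is the
word of `p / q` followed by that of `p' / q'`, because no integer separates the lines of slopes `p /
q` and `(p + p') / (q + q')` on the first `q` steps, and similarly afterwards. Matrices multiply
from right to left. -/
theorem christoffelMat_mediant (lam : ℝ) {p p' : ℤ} {q q' : ℕ} (hq : 0 < q) (hq' : 0 < q')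
    (h : p' * q - p * q' = 1) :
    christoffelMat lam (p + p') (q + q') = christoffelMat lam p' q' * christoffelMat lam p q := by
  rw [christoffelMat, charMat_add]
  congr 1
  · refine charMat_congr fun i hi => ?_
    have h1 := floor_mediant_right hq hq' h (n := i) (by positivity) (by omega)
    have h2 := floor_mediant_right hq hq' h (n := i + 1) (by positivity) (by omega)
    simp only [christoffel]
    have e : (((q + i : ℕ) : ℤ) + 1) = q + (i + 1) := by push_cast; ring
    rw [e, h2, Nat.cast_add q i, h1]
    congr 2; ring
  · refine charMat_congr fun i hi => ?_
    have h1 := floor_mediant_left hq hq' h (n := i) (by positivity) (by omega)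
    have h2 := floor_mediant_left hq hq' h (n := i + 1) (by positivity) (by omega)
    simp only [christoffel]
    rw [h2, h1]

theorem det_christoffelMat (lam : ℝ) (p : ℤ) (q : ℕ) : (christoffelMat lam p q).det = 1 :=
  det_charMat _ _

/-- Cayley-Hamilton: `A² = (tr A) A - 1` when `det A = 1`. -/
theorem trace_sq_mul {R : Type*} [CommRing R] (A B : Matrix (Fin 2) (Fin 2) R) (hA : A.det = 1) :
    (A * (A * B)).trace = A.trace * (A * B).trace - B.trace := by
  rw [Matrix.det_fin_two] at hA
  simp only [Matrix.trace_fin_two, Matrix.mul_apply, Fin.sum_univ_two]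
  linear_combination (-(B 0 0) - B 1 1) * hA

theorem trace_christoffelMat_rec (lam : ℝ) {p p' : ℤ} {q q' : ℕ} (hq : 0 < q) (hq' : 0 < q')
    (h : p' * q - p * q' = 1 ∨ p * q' - p' * q = 1) :
    (christoffelMat lam (p + p' + p') (q + q' + q')).trace
      = (christoffelMat lam p' q').trace * (christoffelMat lam (p + p') (q + q')).trace
        - (christoffelMat lam p q).trace := by
  rcases h with h | h
  · rw [christoffelMat_mediant lam (Nat.add_pos_left hq q') hq' (by push_cast; linear_combination h),
      christoffelMat_mediant lam hq hq' h, trace_sq_mul _ _ (det_christoffelMat _ _ _)]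
  · rw [add_comm _ p', add_comm _ q', christoffelMat_mediant lam hq' (Nat.add_pos_left hq q')
      (by push_cast; linear_combination h), add_comm p, add_comm q,
      christoffelMat_mediant lam hq' hq h, Matrix.trace_mul_comm,
      Matrix.trace_mul_comm (christoffelMat lam p q) (christoffelMat lam p' q'),
      ← trace_sq_mul _ _ (det_christoffelMat lam p' q'),
      Matrix.trace_mul_comm (christoffelMat lam p' q') (christoffelMat lam p' q' * _), mul_assoc]

/-! ### Continued fractions and the trace map -/

/-- Numerators of the convergents of `[0; a 0, a 1, …]`, shifted by one so as to start with `1 / 0`. -/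
def cfNum (a : ℕ → ℕ) : ℕ → ℤ
  | 0 => 1
  | 1 => 0
  | k + 2 => a k * cfNum a (k + 1) + cfNum a k

/-- Denominators of the convergents of `[0; a 0, a 1, …]`, shifted by one so as to start with
`1 / 0`. -/
def cfDen (a : ℕ → ℕ) : ℕ → ℕ
  | 0 => 0
  | 1 => 1
  | k + 2 => a k * cfDen a (k + 1) + cfDen a k

theorem cfDen_pos {a : ℕ → ℕ} (ha : ∀ k, 1 ≤ a k) (k : ℕ) : 0 < cfDen a (k + 1) := by
  induction k with
  | zero => simp [cfDen]
  | succ k ih => exact Nat.add_pos_left (Nat.mul_pos (ha k) ih) _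

theorem cf_det (a : ℕ → ℕ) (k : ℕ) :
    cfNum a (k + 1) * cfDen a k - cfNum a k * cfDen a (k + 1) = 1 ∨
      cfNum a k * cfDen a (k + 1) - cfNum a (k + 1) * cfDen a k = 1 := by
  induction k with
  | zero => simp [cfNum, cfDen]
  | succ k ih =>
    simp only [cfNum, cfDen]
    push_cast
    rcases ih with ih | ih
    · right; linear_combination ih
    · left; linear_combination ih

/-- The sequence `y₀, y₁, x y₁ - y₀, …` of the recursion `y_{n+2} = x y_{n+1} - y_n`. -/
def chain {R : Type*} [CommRing R] (x y₀ y₁ : R) : ℕ → R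
  | 0 => y₀
  | 1 => y₁
  | n + 2 => x * chain x y₀ y₁ (n + 1) - chain x y₀ y₁ n

/-- The traces of the transfer matrices over two consecutive convergents and over their mediant,
generated by the trace map. -/
def traceTriple (lam : ℝ) (a : ℕ → ℕ) : ℕ → ℝ[X] × ℝ[X] × ℝ[X]
  | 0 => (2, X, X - C lam)
  | k + 1 =>
    ((traceTriple lam a k).2.1,
      chain (traceTriple lam a k).2.1 (traceTriple lam a k).1 (traceTriple lam a k).2.2 (a k),
      chain (traceTriple lam a k).2.1 (traceTriple lam a k).1 (traceTriple lam a k).2.2 (a k + 1))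

theorem trace_christoffelMat_chain (lam : ℝ) {a : ℕ → ℕ} (ha : ∀ k, 1 ≤ a k) (k n : ℕ) :
    (christoffelMat lam (cfNum a k + n * cfNum a (k + 1)) (cfDen a k + n * cfDen a (k + 1))).trace
      = chain (christoffelMat lam (cfNum a (k + 1)) (cfDen a (k + 1))).trace
          (christoffelMat lam (cfNum a k) (cfDen a k)).trace
          (christoffelMat lam (cfNum a k + cfNum a (k + 1)) (cfDen a k + cfDen a (k + 1))).trace
          n := by
  induction n using Nat.twoStepInduction with
  | zero => simp [chain]
  | one => simp [chain]
  | more n ih1 ih2 =>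
    rw [chain, ← ih1, ← ih2]
    -- The formal fraction `1 / 0` has an empty word, so the mediant identity does not cover this
    -- one step; it is computed by hand.
    by_cases h0 : k = 0 ∧ n = 0
    · obtain ⟨rfl, rfl⟩ := h0
      simp only [cfNum, cfDen]
      norm_num [christoffelMat, charMat, christoffel, stepMat, Matrix.trace_fin_two]
      ring
    · have hq : 0 < cfDen a k + n * cfDen a (k + 1) := by
        have h1 := cfDen_pos ha k
        rcases Nat.eq_zero_or_pos k with rfl | hk
        · have : 0 < n := by omega
          positivity
        · obtain ⟨j, rfl⟩ : ∃ j, k = j + 1 := ⟨k - 1, by omega⟩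
          have := cfDen_pos ha j
          positivity
      have := trace_christoffelMat_rec lam (p := cfNum a k + n * cfNum a (k + 1))
        (p' := cfNum a (k + 1)) hq (cfDen_pos ha k) (by
          push_cast
          rcases cf_det a k with h | h
          · left; linear_combination h
          · right; linear_combination h)
      convert this using 3 <;> push_cast <;> ring_nf

theorem traceTriple_eq (lam : ℝ) {a : ℕ → ℕ} (ha : ∀ k, 1 ≤ a k) (k : ℕ) :
    traceTriple lam a k =
      ((christoffelMat lam (cfNum a k) (cfDen a k)).trace,
        (christoffelMat lam (cfNum a (k + 1)) (cfDen a (k + 1))).trace,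
        (christoffelMat lam (cfNum a k + cfNum a (k + 1)) (cfDen a k + cfDen a (k + 1))).trace) := by
  induction k with
  | zero =>
    simp [traceTriple, cfNum, cfDen, christoffelMat, charMat, christoffel, stepMat,
      Matrix.trace_fin_two]
  | succ k ih =>
    rw [traceTriple, ih]
    simp only
    rw [← trace_christoffelMat_chain lam ha, ← trace_christoffelMat_chain lam ha]
    simp only [cfNum, cfDen]
    refine Prod.ext rfl (Prod.ext ?_ ?_) <;> simp only
    · rw [add_comm, add_comm (cfDen a k)]
    · congr 2
      · push_cast; ring
      · ring

theorem chain_map {R S : Type*} [CommRing R] [CommRing S] (f : R →+* S) (x y₀ y₁ : R) (n : ℕ) :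
    f (chain x y₀ y₁ n) = chain (f x) (f y₀) (f y₁) n := by
  induction n using Nat.twoStepInduction with
  | zero => rfl
  | one => rfl
  | more n ih1 ih2 => rw [chain, chain, map_sub, map_mul, ih1, ih2]

/-- The Fricke-Vogt invariant: `y_n` and `y_{n+2}` are the two roots of the same quadratic, whose
sum is `x y_{n+1}`. -/
theorem chain_invariant {R : Type*} [CommRing R] (x y₀ y₁ : R) (n : ℕ) :
    x ^ 2 + chain x y₀ y₁ n ^ 2 + chain x y₀ y₁ (n + 1) ^ 2
      - x * chain x y₀ y₁ n * chain x y₀ y₁ (n + 1) = x ^ 2 + y₀ ^ 2 + y₁ ^ 2 - x * y₀ * y₁ := by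
  induction n with
  | zero => rfl
  | succ n ih => rw [← ih, chain]; ring

theorem traceTriple_invariant (lam : ℝ) (a : ℕ → ℕ) (k : ℕ) :
    (traceTriple lam a k).2.1 ^ 2 + (traceTriple lam a k).1 ^ 2 + (traceTriple lam a k).2.2 ^ 2
      - (traceTriple lam a k).2.1 * (traceTriple lam a k).1 * (traceTriple lam a k).2.2
      = C (lam ^ 2 + 4) := by
  induction k with
  | zero => simp only [traceTriple, C_add, C_pow]; rw [show C (4 : ℝ) = 4 from rfl]; ring
  | succ k ih =>
    have h := chain_invariant (traceTriple lam a k).2.1 (traceTriple lam a k).1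
      (traceTriple lam a k).2.2 (a k)
    simp only [traceTriple]
    linear_combination h + ih

/-! ### Derivatives of the traces along one chain -/

/-- At `x = ±2` the sequence `(±1)^n y_n` is an arithmetic progression, with step `±λ` by the
invariant. Starting in `[-2, 2]`, it can never return there, since `λ > 4`. -/
theorem abs_lt_two_of_chain {lam x : ℝ} {y : ℕ → ℝ} (hlam : 20 < lam)
    (hy : ∀ n, y (n + 2) = x * y (n + 1) - y n)
    (hI : x ^ 2 + y 0 ^ 2 + y 1 ^ 2 - x * y 0 * y 1 = lam ^ 2 + 4)
    (hx : |x| ≤ 2) (h0 : |y 0| ≤ 2) {p : ℕ} (hp : 1 ≤ p) (hyp : |y p| ≤ 2) : |x| < 2 := by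
  refine lt_of_le_of_ne hx fun hx2 => ?_
  obtain ⟨σ, hσ, hxσ⟩ : ∃ σ : ℝ, |σ| = 1 ∧ x = 2 * σ := by
    refine ⟨x / 2, ?_, by ring⟩
    rw [abs_div, hx2]; norm_num
  have hσ2 : σ ^ 2 = 1 := by rw [← sq_abs, hσ, one_pow]
  have key : ∀ n, σ ^ n * y n = y 0 + n * (σ * y 1 - y 0) ∧
      σ ^ (n + 1) * y (n + 1) = y 0 + (n + 1) * (σ * y 1 - y 0) := by
    intro n
    induction n with
    | zero => constructor <;> simp
    | succ n ih =>
      refine ⟨by push_cast; exact ih.2, ?_⟩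
      rw [hy, hxσ]
      push_cast
      linear_combination 2 * ih.2 - ih.1 + (2 * σ ^ (n + 1) * y (n + 1) - σ ^ n * y n) * hσ2
  have hsq : (σ * y 1 - y 0) ^ 2 = lam ^ 2 := by
    rw [hxσ] at hI
    linear_combination hI + (y 1 ^ 2 - 4) * hσ2
  have habs : |σ * y 1 - y 0| = lam := by
    rw [← abs_of_pos (show 0 < lam by linarith)]; exact (sq_eq_sq_iff_abs_eq_abs _ _).1 hsq
  have h1 : |σ ^ p * y p| ≤ 2 := by rw [abs_mul, abs_pow, hσ, one_pow, one_mul]; exact hyp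
  rw [(key p).1] at h1
  have h2 : |(p : ℝ) * (σ * y 1 - y 0)| = p * lam := by rw [abs_mul, habs, Nat.abs_cast]
  have h3 : |(p : ℝ) * (σ * y 1 - y 0)| ≤ 4 := by
    calc _ = |(y 0 + p * (σ * y 1 - y 0)) - y 0| := by ring_nf
      _ ≤ _ := (abs_sub _ _).trans (by linarith)
  have hp1 : (1 : ℝ) ≤ p := by exact_mod_cast hp
  nlinarith

-- With `x = 2 cos φ` the recursion is a rotation: `y_n = r cos (nφ + ψ)`, and the invariant fixes
-- `r² = 4 + λ² / sin² φ`. Differentiating, the phase contributes `nφ'` times `r sin (nφ + ψ)`,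
-- which is huge wherever `y_n` is small. The contributions of `r'` and `ψ'` are controlled by the
-- data at `n = 0`, and for `p ≥ 2` the term in `φ'` wins by the stated factor.
set_option maxHeartbeats 1000000 in
theorem elliptic_chain {lam x x' : ℝ} {y d : ℕ → ℝ} (hlam : 20 < lam)
    (hy : ∀ n, y (n + 2) = x * y (n + 1) - y n)
    (hd : ∀ n, d (n + 2) = x' * y (n + 1) + x * d (n + 1) - d n)
    (hI : x ^ 2 + y 0 ^ 2 + y 1 ^ 2 - x * y 0 * y 1 = lam ^ 2 + 4)
    (hI' : (2 * x - y 0 * y 1) * x' + (2 * y 0 - x * y 1) * d 0 + (2 * y 1 - x * y 0) * d 1 = 0)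
    (hx : |x| ≤ 2) (h0 : |y 0| ≤ 2) (hd0 : |d 0| ≤ |x'|) {p : ℕ} (hp : 1 ≤ p)
    (hyp : |y p| ≤ 2) : (lam - 8) / 3 * |x'| ≤ |d p| := by
  have hxlt := abs_lt_two_of_chain hlam hy hI hx h0 hp hyp
  -- Three traces of modulus at most 2 would make the invariant at most 20, so `p = 1` is
  -- impossible. The factor 2 matters: with `p = 1` the term in `ψ'` could cancel the term in `φ'`.
  have hp2 : 2 ≤ p := by
    by_contra hlt
    obtain rfl : p = 1 := by omega
    have a1 := abs_le.1 hx
    have a2 := abs_le.1 h0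
    have a3 := abs_le.1 hyp
    have h1 : |x * y 0 * y 1| ≤ 2 * 2 * 2 := by
      rw [abs_mul, abs_mul]; gcongr
    have := (abs_le.1 h1).1
    nlinarith
  obtain ⟨c, rfl⟩ : ∃ c, x = 2 * c := ⟨x / 2, by ring⟩
  have hc1 : |c| < 1 := by rw [abs_mul, abs_two] at hxlt; linarith
  have hcs : 0 < 1 - c ^ 2 := by have := (sq_lt_one_iff_abs_lt_one c).2 hc1; linarith
  obtain ⟨s, hs, hs2⟩ : ∃ s : ℝ, 0 < s ∧ s ^ 2 = 1 - c ^ 2 :=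
    ⟨√(1 - c ^ 2), Real.sqrt_pos.2 hcs, Real.sq_sqrt hcs.le⟩
  have hs1 : s ^ 2 ≤ 1 := by nlinarith [sq_nonneg c]
  -- `Z n` is the sine partner `r sin (nφ + ψ)` of `y n`, with `c = cos φ` and `s = sin φ`.
  obtain ⟨Z, hZ⟩ : ∃ Z : ℕ → ℝ, ∀ n, y (n + 1) = c * y n - s * Z n :=
    ⟨fun n => (c * y n - y (n + 1)) / s, fun n => by field_simp; ring⟩
  have hZ1 : ∀ n, Z (n + 1) = s * y n + c * Z n := by
    intro n
    have h1 := hZ (n + 1)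
    rw [hy, hZ n] at h1
    refine mul_left_cancel₀ hs.ne' ?_
    linear_combination h1 - y n * hs2
  have hK : ∀ n, s ^ 2 * (y n ^ 2 + Z n ^ 2) = lam ^ 2 + 4 * s ^ 2 := by
    intro n
    induction n with
    | zero =>
      have h1 := hZ 0
      rw [zero_add] at h1
      rw [h1] at hI
      linear_combination hI + (y 0 ^ 2 - 4) * hs2
    | succ n ih =>
      rw [hZ1, hZ]
      linear_combination ih + s ^ 2 * (y n ^ 2 + Z n ^ 2) * hs2
  have hlow : ∀ n, |y n| ≤ 2 → lam ≤ s * |Z n| := by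
    intro n hn
    have h4 : y n ^ 2 ≤ 4 := by rw [← sq_abs]; nlinarith [abs_nonneg (y n)]
    have : lam ^ 2 ≤ (s * |Z n|) ^ 2 := by
      rw [mul_pow, sq_abs]; nlinarith [hK n, sq_nonneg s]
    exact le_of_sq_le_sq this (by positivity)
  have hZ0 : 0 < |Z 0| := by
    have := hlow 0 h0
    by_contra hle
    have h5 : |Z 0| = 0 := le_antisymm (not_lt.1 hle) (abs_nonneg _)
    rw [h5] at this; linarith
  have hZ0' : Z 0 ≠ 0 := abs_pos.1 hZ0
  have hden : 0 < lam ^ 2 + 4 * s ^ 2 := by positivity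
  obtain ⟨A, hA⟩ : ∃ A : ℝ, A * (2 * s ^ 2) = |x'| := ⟨|x'| / (2 * s ^ 2), by field_simp⟩
  have hA0 : 0 ≤ A := by
    by_contra hneg
    have := abs_nonneg x'
    nlinarith [mul_pos (neg_pos.2 (not_le.1 hneg)) (show 0 < 2 * s ^ 2 by positivity)]
  -- In polar terms `κ = r' / r`, `h = φ'` and `g = ψ'`; `g` is determined by `d 0`. All three are
  -- defined algebraically, and `hdn` is the differentiated cosine formula.
  obtain ⟨κ, hκ⟩ : ∃ κ : ℝ, κ * (2 * s ^ 2 * (lam ^ 2 + 4 * s ^ 2)) = lam ^ 2 * c * x' :=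
    ⟨lam ^ 2 * c * x' / (2 * s ^ 2 * (lam ^ 2 + 4 * s ^ 2)), by field_simp⟩
  obtain ⟨h, hh⟩ : ∃ h : ℝ, h * (2 * s) = -x' := ⟨-x' / (2 * s), by field_simp⟩
  obtain ⟨g, hg⟩ : ∃ g : ℝ, Z 0 * g = κ * y 0 - d 0 := ⟨(κ * y 0 - d 0) / Z 0, by field_simp⟩
  have hκA : |κ| ≤ A := by
    have h1 : |κ| * (2 * s ^ 2 * (lam ^ 2 + 4 * s ^ 2)) = lam ^ 2 * |c| * |x'| := by
      have := congrArg abs hκ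
      rw [abs_mul κ, abs_of_pos (by positivity : 0 < 2 * s ^ 2 * (lam ^ 2 + 4 * s ^ 2)), abs_mul,
        abs_mul, abs_of_pos (by positivity : 0 < lam ^ 2)] at this
      exact this
    refine le_of_mul_le_mul_right ?_ (show 0 < 2 * s ^ 2 * (lam ^ 2 + 4 * s ^ 2) by positivity)
    rw [h1, ← mul_assoc, hA, mul_comm]
    refine mul_le_mul_of_nonneg_left ?_ (abs_nonneg _)
    nlinarith [sq_nonneg lam, sq_nonneg s]
  have hhA : |h| = A * s := by
    have h1 : |h| * (2 * s) = |x'| := by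
      rw [← abs_neg x', ← hh, abs_mul, abs_of_pos (by positivity : 0 < 2 * s)]
    refine mul_right_cancel₀ (show 2 * s ≠ 0 by positivity) ?_
    rw [h1, ← hA]; ring
  have hdn : ∀ n, d n = κ * y n - Z n * (g + n * h) ∧
      d (n + 1) = κ * y (n + 1) - Z (n + 1) * (g + (n + 1) * h) := by
    intro n
    induction n with
    | zero =>
      refine ⟨by push_cast; linear_combination hg, ?_⟩
      have h1 := hZ 0
      have h2 := hZ1 0
      rw [zero_add] at h1 h2
      have hK0 := hK 0
      refine mul_left_cancel₀ (show 2 * s * Z 0 * s ^ 2 ≠ 0 by positivity) ?_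
      rw [zero_add, h2]
      rw [h1] at hI' ⊢
      push_cast
      linear_combination (-s ^ 2) * hI' + 2 * s ^ 3 * (s * y 0 + c * Z 0) * hg
        + s ^ 2 * Z 0 * (s * y 0 + c * Z 0) * hh + (2 * s ^ 2 * κ - c * x') * hK0 + hκ
        - 2 * s ^ 2 * y 0 * d 0 * hs2
    | succ n ih =>
      refine ⟨by push_cast; exact ih.2, ?_⟩
      have e1 := hZ1 (n + 1)
      have e2 := hZ1 n
      have e3 := hZ n
      rw [hd, ih.1, ih.2, e1, hy]
      push_cast
      rw [e2, e3]
      linear_combination (c * y n - s * Z n) * hh - Z n * (g + n * h) * hs2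
  have hlowp := hlow p hyp
  have hlow0 := hlow 0 h0
  -- Since `λ > 20`, the bounds `λ² ≤ s² Z²` (where `y` is small) and `s² Z² ≤ λ² + 4` differ by a
  -- factor of at most 1.01.
  have hratio : |Z p| ≤ 1.01 * |Z 0| := by
    refine le_of_sq_le_sq ?_ (by positivity)
    rw [sq_abs]
    have h1 := hK p
    have h2 : lam ^ 2 ≤ s ^ 2 * |Z 0| ^ 2 := by
      rw [← mul_pow]; exact pow_le_pow_left₀ (by linarith) hlow0 2
    refine le_of_mul_le_mul_left ?_ (show 0 < s ^ 2 by positivity)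
    have h3 : s ^ 2 * Z p ^ 2 ≤ lam ^ 2 + 4 * s ^ 2 := by
      linarith [mul_nonneg (sq_nonneg s) (sq_nonneg (y p))]
    have h4 : (400 : ℝ) ≤ lam ^ 2 := by nlinarith
    calc s ^ 2 * Z p ^ 2 ≤ 1.0201 * lam ^ 2 := by linarith
      _ ≤ 1.0201 * (s ^ 2 * |Z 0| ^ 2) := by linarith
      _ = _ := by ring
  have hg1 : |Z p * g| ≤ 1.01 * (2 * A + |x'|) := by
    have h1 : |Z 0| * |g| ≤ 2 * A + |x'| := by
      rw [← abs_mul, hg]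
      refine (abs_sub _ _).trans ?_
      rw [abs_mul]
      nlinarith [abs_nonneg (y 0), abs_nonneg κ]
    rw [abs_mul]
    calc |Z p| * |g| ≤ 1.01 * |Z 0| * |g| := by gcongr
      _ ≤ _ := by rw [mul_assoc]; gcongr
  have hκ1 : |κ * y p| ≤ 2 * A := by
    rw [abs_mul]; nlinarith [abs_nonneg (y p), abs_nonneg κ]
  have hmain : 2 * lam * A ≤ |Z p * (p * h)| := by
    have hp' : (2 : ℝ) ≤ p := by exact_mod_cast hp2
    rw [abs_mul, abs_mul, hhA, Nat.abs_cast]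
    calc 2 * lam * A = (2 * A) * lam := by ring
      _ ≤ (p * A) * (s * |Z p|) := by gcongr
      _ = _ := by ring
  have htri : |Z p * (p * h)| ≤ |d p| + |κ * y p| + |Z p * g| := by
    have : Z p * (p * h) = -d p + κ * y p - Z p * g := by rw [(hdn p).1]; ring
    rw [this]
    refine (abs_sub _ _).trans ?_
    gcongr
    exact (abs_add_le _ _).trans (by rw [abs_neg])
  have hAx : |x'| ≤ 2 * A := by nlinarith
  have := abs_nonneg x'
  nlinarith

/-- When `u` and `z` are both small, the invariant, read as a quadratic in `x`, forces `|x| ≥ 18`.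
Its derivative bounds `|x'|` by `2.4 |z'|`, so `x z'` dominates the derivative of the next trace `x
z - u`. -/
theorem hyperbolic_step {lam x u z x' u' z' : ℝ} (hlam : 20 < lam)
    (hI : x ^ 2 + u ^ 2 + z ^ 2 - x * u * z = lam ^ 2 + 4)
    (hI' : (2 * x - u * z) * x' + (2 * u - x * z) * u' + (2 * z - x * u) * z' = 0)
    (hu : |u| ≤ 2) (hz : |z| ≤ 2) (hd : |u'| ≤ |z'|) : |z'| ≤ |x' * z + x * z' - u'| := by
  have hu4 : u ^ 2 ≤ 4 := by rw [← sq_abs]; nlinarith [abs_nonneg u]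
  have hz4 : z ^ 2 ≤ 4 := by rw [← sq_abs]; nlinarith [abs_nonneg z]
  have huz : |u * z| ≤ 4 := by rw [abs_mul]; nlinarith [abs_nonneg u, abs_nonneg z]
  -- `ρ²` is the discriminant of the invariant as a quadratic in `x`.
  set ρ := 2 * x - u * z with hρ
  have hρ40 : 40 ≤ |ρ| := by
    refine le_of_sq_le_sq ?_ (abs_nonneg _)
    rw [sq_abs]
    have : ρ ^ 2 = 4 * lam ^ 2 + (4 - u ^ 2) * (4 - z ^ 2) := by rw [hρ]; linear_combination 4 * hI
    nlinarith [mul_nonneg (sub_nonneg.2 hu4) (sub_nonneg.2 hz4)]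
  have h2x : 2 * x = ρ + u * z := by rw [hρ]; ring
  have hx1 : 2 * |x| ≤ |ρ| + 4 := by
    have : |2 * x| ≤ |ρ| + |u * z| := by rw [h2x]; exact abs_add_le _ _
    rw [abs_mul, abs_two] at this; linarith
  have hx2 : |ρ| ≤ 2 * |x| + 4 := by
    have := abs_sub (2 * x) (u * z)
    rw [abs_mul, abs_two] at this; linarith
  have hD := abs_nonneg z'
  have hb1 : |2 * u - x * z| ≤ 4 + 2 * |x| := by
    refine (abs_sub _ _).trans ?_
    rw [abs_mul, abs_mul, abs_two]; nlinarith [abs_nonneg x]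
  have hb2 : |2 * z - x * u| ≤ 4 + 2 * |x| := by
    refine (abs_sub _ _).trans ?_
    rw [abs_mul, abs_mul, abs_two]; nlinarith [abs_nonneg x]
  have h1 : |ρ| * |x'| ≤ (8 + 4 * |x|) * |z'| := by
    have : ρ * x' = -((2 * u - x * z) * u') - (2 * z - x * u) * z' := by linear_combination hI'
    rw [← abs_mul, this]
    refine (abs_sub _ _).trans ?_
    rw [abs_neg, abs_mul, abs_mul]
    have := mul_le_mul hb1 hd (abs_nonneg _) (by positivity)
    have := mul_le_mul_of_nonneg_right hb2 hD
    linarith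
  have h2 : |x'| ≤ 2.4 * |z'| := by
    refine le_of_mul_le_mul_left ?_ (show 0 < |ρ| by linarith)
    nlinarith
  have h3 : |x * z'| ≤ |x' * z + x * z' - u'| + |x' * z| + |u'| := by
    have : x * z' = (x' * z + x * z' - u') - x' * z + u' := by ring
    calc |x * z'| = |(x' * z + x * z' - u') - x' * z + u'| := by rw [← this]
      _ ≤ _ := (abs_add_le _ _).trans (by gcongr; exact abs_sub _ _)
  rw [abs_mul x z', abs_mul x' z] at h3
  have h4 : |x'| * |z| ≤ 2.4 * |z'| * 2 := mul_le_mul h2 hz (abs_nonneg _) (by positivity)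
  nlinarith

/-- `x u - z` is the element preceding `u`, so a chain can be started one step earlier. -/
theorem chain_shift {R : Type*} [CommRing R] (x u z : R) (n : ℕ) :
    chain x (x * u - z) u (n + 1) = chain x u z n := by
  induction n using Nat.twoStepInduction with
  | zero => rfl
  | one => simp [chain]
  | more n ih1 ih2 => rw [chain, ih1, ih2, chain]

/-! ### Growth of the derivatives at energies without escape -/

/-- The traces along the chain of intermediate convergents at level `k`. -/
def traceChain (lam : ℝ) (a : ℕ → ℕ) (k n : ℕ) : ℝ[X] :=
  chain (traceTriple lam a k).2.1 (traceTriple lam a k).1 (traceTriple lam a k).2.2 n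

/-- At the energy `E` no two neighbouring traces along the path of intermediate convergents leave
`[-2, 2]` simultaneously. -/
def NoEscape (lam : ℝ) (a : ℕ → ℕ) (E : ℝ) : Prop :=
  ∀ k n, n < a k → |(traceChain lam a k n).eval E| ≤ 2 →
    2 < |(traceTriple lam a k).2.1.eval E| → |(traceChain lam a k (n + 1)).eval E| ≤ 2

/-- The possible positions of an energy of the spectrum relative to the bands of three traces
`u`, `x`, `z`, with a lower bound `b` for the derivative of the most recent small trace. -/
def BandState (lam : ℝ) (u x z : ℝ[X]) (E b : ℝ) : Prop :=
  (|u.eval E| ≤ 2 ∧ |x.eval E| ≤ 2 ∧ |u.derivative.eval E| ≤ |x.derivative.eval E| ∧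
    b ≤ |x.derivative.eval E|) ∨
  (|u.eval E| ≤ 2 ∧ |z.eval E| ≤ 2 ∧ 2 < |x.eval E| ∧
    |u.derivative.eval E| ≤ |z.derivative.eval E| ∧ b ≤ |z.derivative.eval E|) ∨
  (|x.eval E| ≤ 2 ∧ |(x * u - z).eval E| ≤ 2 ∧
    |(x * u - z).derivative.eval E| ≤ |x.derivative.eval E| ∧
    b ≤ xi lam * |x.derivative.eval E|)

theorem xi_sq {lam : ℝ} (hlam : 20 < lam) : xi lam ^ 2 = (lam - 8) / 3 :=
  Real.sq_sqrt (by linarith)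

theorem two_lt_xi {lam : ℝ} (hlam : 20 < lam) : 2 < xi lam := by
  rw [xi]; exact Real.lt_sqrt_of_sq_lt (by linarith)

theorem elliptic_chain_eval {lam E : ℝ} (hlam : 20 < lam) {x u z : ℝ[X]}
    (hI : x ^ 2 + u ^ 2 + z ^ 2 - x * u * z = C (lam ^ 2 + 4))
    (hx : |x.eval E| ≤ 2) (hu : |u.eval E| ≤ 2)
    (hd : |u.derivative.eval E| ≤ |x.derivative.eval E|) {p : ℕ} (hp : 1 ≤ p)
    (hyp : |(chain x u z p).eval E| ≤ 2) :
    (lam - 8) / 3 * |x.derivative.eval E| ≤ |(chain x u z p).derivative.eval E| := by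
  have h1 := congrArg (eval E) hI
  have h2 := congrArg (fun P => eval E (derivative P)) hI
  simp only [eval_sub, eval_add, eval_mul, eval_pow, eval_C, derivative_sub,
    derivative_mul, derivative_pow, derivative_C, eval_zero, Nat.cast_ofNat,
    Nat.add_one_sub_one, pow_one, map_add, map_pow, mul_zero, add_zero] at h1 h2
  refine elliptic_chain (y := fun n => (chain x u z n).eval E)
    (d := fun n => (chain x u z n).derivative.eval E) hlam (fun n => ?_) (fun n => ?_) ?_ ?_ hx hu
    hd hp hyp
  · simp [chain]
  · simp [chain]
  · simp only [chain]
    linear_combination h1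
  · simp only [chain]
    linear_combination h2

theorem hyperbolic_chain_eval {lam E b : ℝ} (hlam : 20 < lam) {x u z : ℝ[X]}
    (hI : x ^ 2 + u ^ 2 + z ^ 2 - x * u * z = C (lam ^ 2 + 4))
    (hd : |u.derivative.eval E| ≤ |z.derivative.eval E|) (hb : b ≤ |z.derivative.eval E|) {n : ℕ}
    (hsmall : ∀ i ≤ n + 1, |(chain x u z i).eval E| ≤ 2) :
    |(chain x u z n).derivative.eval E| ≤ |(chain x u z (n + 1)).derivative.eval E| ∧
      b ≤ |(chain x u z (n + 1)).derivative.eval E| := by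
  induction n with
  | zero => exact ⟨hd, hb⟩
  | succ n ih =>
    have ih := ih fun i hi => hsmall i (by omega)
    have hJ := chain_invariant x u z n
    rw [hI] at hJ
    have h1 := congrArg (eval E) hJ
    have h2 := congrArg (fun P => eval E (derivative P)) hJ
    simp only [eval_sub, eval_add, eval_mul, eval_pow, eval_C, derivative_sub,
      derivative_mul, derivative_pow, derivative_C, eval_zero, Nat.cast_ofNat,
      Nat.add_one_sub_one, pow_one, map_add, map_pow, mul_zero, add_zero] at h1 h2
    have key := hyperbolic_step (x := x.eval E) (u := (chain x u z n).eval E)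
      (z := (chain x u z (n + 1)).eval E) (x' := x.derivative.eval E)
      (u' := (chain x u z n).derivative.eval E) (z' := (chain x u z (n + 1)).derivative.eval E)
      hlam (by linear_combination h1) (by linear_combination h2) (hsmall n (by omega))
      (hsmall (n + 1) (by omega)) ih.1
    have e : (chain x u z (n + 1 + 1)).derivative.eval E
        = x.derivative.eval E * (chain x u z (n + 1)).eval E
          + x.eval E * (chain x u z (n + 1)).derivative.eval E
          - (chain x u z n).derivative.eval E := by
      simp [chain]
    rw [← e] at key
    exact ⟨key, ih.2.trans key⟩

/-- From the first or third state the pivot `x` is small and `elliptic_chain` gains `ξ²`; the second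
state only preserves the derivative. The third state, reached after the second, therefore carries a
debt: its bound is `b ≤ ξ |x'|` instead of `b ≤ |x'|`. The surplus `ξ` of the next elliptic level
repays it, so `b` grows by `ξ` at every level. -/
theorem BandState.step {lam E b : ℝ} {a : ℕ → ℕ} (hlam : 20 < lam) (ha : ∀ k, 1 ≤ a k)
    (hE : NoEscape lam a E) (hb : 0 ≤ b) {k : ℕ}
    (h : BandState lam (traceTriple lam a k).1 (traceTriple lam a k).2.1 (traceTriple lam a k).2.2
      E b) :
    BandState lam (traceTriple lam a (k + 1)).1 (traceTriple lam a (k + 1)).2.1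
      (traceTriple lam a (k + 1)).2.2 E (xi lam * b) := by
  have hξ := two_lt_xi hlam
  have hξ2 := xi_sq hlam
  have hI := traceTriple_invariant lam a k
  -- If the next pivot is large, absence of escape at level `k + 1` makes the neighbouring mediant
  -- trace small.
  have hnext : ∀ hx : |(traceTriple lam a k).2.1.eval E| ≤ 2,
      ¬ |(traceChain lam a k (a k)).eval E| ≤ 2 → |(traceChain lam a k (a k + 1)).eval E| ≤ 2 := by
    intro hx hlt
    have := hE (k + 1) 0 (ha (k + 1)) (by simpa [traceChain, chain, traceTriple] using hx)
      (by simpa [traceTriple, traceChain] using hlt)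
    simpa [traceChain, chain, traceTriple] using this
  have hfin : ∀ (hx : |(traceTriple lam a k).2.1.eval E| ≤ 2),
      b ≤ xi lam * |(traceTriple lam a k).2.1.derivative.eval E| →
      (∀ p, a k ≤ p → |(traceChain lam a k p).eval E| ≤ 2 →
        (lam - 8) / 3 * |(traceTriple lam a k).2.1.derivative.eval E|
          ≤ |(traceChain lam a k p).derivative.eval E|) →
      BandState lam (traceTriple lam a (k + 1)).1 (traceTriple lam a (k + 1)).2.1
        (traceTriple lam a (k + 1)).2.2 E (xi lam * b) := by
    intro hx hbx hgain
    have hD := abs_nonneg ((traceTriple lam a k).2.1.derivative.eval E)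
    have hw : ∀ p, a k ≤ p → |(traceChain lam a k p).eval E| ≤ 2 →
        |(traceTriple lam a k).2.1.derivative.eval E|
          ≤ |(traceChain lam a k p).derivative.eval E| ∧
        xi lam * b ≤ |(traceChain lam a k p).derivative.eval E| := by
      intro p hp hsm
      have := hgain p hp hsm
      rw [← hξ2] at this
      constructor <;> nlinarith
    by_cases hsm : |(traceChain lam a k (a k)).eval E| ≤ 2
    · exact Or.inl ⟨hx, hsm, hw _ le_rfl hsm⟩
    · have := hnext hx hsm
      exact Or.inr (Or.inl ⟨hx, this, not_le.1 hsm, hw _ (Nat.le_succ _) this⟩)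
  rcases h with ⟨hu, hx, hd, hbx⟩ | ⟨hu, hz, hx, hd, hbz⟩ | ⟨hx, hu, hd, hbx⟩
  · refine hfin hx (by nlinarith) fun p hp hsm => ?_
    exact elliptic_chain_eval hlam hI hx hu hd ((ha k).trans hp) hsm
  · have hsmall : ∀ i ≤ a k, |(traceChain lam a k i).eval E| ≤ 2 := by
      intro i
      induction i with
      | zero => exact fun _ => hu
      | succ i ih => exact fun hi => hE k i hi (ih (by omega)) hx
    obtain ⟨m, hm⟩ : ∃ m, a k = m + 1 := ⟨a k - 1, by have := ha k; omega⟩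
    have key := hyperbolic_chain_eval (n := m) hlam hI hd hbz (by rw [← hm]; exact hsmall)
    have e : (traceTriple lam a (k + 1)).2.1 * (traceTriple lam a (k + 1)).1
        - (traceTriple lam a (k + 1)).2.2 = traceChain lam a k m := by
      simp only [traceTriple, hm, traceChain]
      rw [chain]; ring
    have e' : (traceTriple lam a (k + 1)).2.1 = traceChain lam a k (m + 1) := by
      simp only [traceTriple, hm, traceChain]
    refine Or.inr (Or.inr ?_)
    rw [e, e']
    refine ⟨hsmall _ hm.ge, hsmall _ (by omega), key.1, ?_⟩
    exact mul_le_mul_of_nonneg_left key.2 (by linarith)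
  · refine hfin hx hbx fun p hp hsm => ?_
    -- In this state it is the predecessor `x u - z`, not `u`, whose derivative is dominated by that
    -- of `x`; the elliptic estimate is applied to the chain started there.
    have hJ := chain_invariant (traceTriple lam a k).2.1
      ((traceTriple lam a k).2.1 * (traceTriple lam a k).1 - (traceTriple lam a k).2.2)
      (traceTriple lam a k).1 1
    rw [chain_shift, chain_shift] at hJ
    simp only [chain] at hJ
    rw [hI] at hJ
    have := elliptic_chain_eval hlam hJ.symm hx hu hd (p := p + 1) (by omega)
      (by rw [chain_shift]; exact hsm)
    rwa [chain_shift] at this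

theorem bandState_traceTriple {lam E : ℝ} {a : ℕ → ℕ} (hlam : 20 < lam) (ha : ∀ k, 1 ≤ a k)
    (hE : NoEscape lam a E) (k : ℕ) :
    BandState lam (traceTriple lam a k).1 (traceTriple lam a k).2.1 (traceTriple lam a k).2.2 E
      (xi lam ^ k) := by
  have hξ := two_lt_xi hlam
  induction k with
  | zero =>
    by_cases hx : |E| ≤ 2
    · left; simp [traceTriple, hx]
    · right; left
      have := hE 0 0 (ha 0) (by simp [traceChain, chain, traceTriple])
        (by simpa [traceTriple] using hx)
      refine ⟨by simp [traceTriple], this, by simpa [traceTriple] using hx, ?_, ?_⟩ <;>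
        simp [traceTriple]
  | succ k ih =>
    rw [pow_succ']
    exact ih.step hlam ha hE (by positivity)

theorem abs_le_of_noEscape {lam E : ℝ} {a : ℕ → ℕ} (hlam : 20 < lam) (ha : ∀ k, 1 ≤ a k)
    (hE : NoEscape lam a E) : |E| ≤ lam + 2 := by
  by_cases hx : |E| ≤ 2
  · linarith
  · have := hE 0 0 (ha 0) (by simp [traceChain, chain, traceTriple])
        (by simpa [traceTriple] using hx)
    simp only [traceChain, chain, traceTriple, eval_sub, eval_X, eval_C] at this
    rw [abs_le] at this ⊢
    constructor <;> linarith

/-- At an energy without escape, one of two consecutive traces has a large derivative. -/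
theorem exists_le_derivative {lam E : ℝ} {a : ℕ → ℕ} (hlam : 20 < lam) (ha : ∀ k, 1 ≤ a k)
    (hE : NoEscape lam a E) (k : ℕ) :
    ∃ j, (j = k ∨ j = k + 1) ∧
      xi lam ^ k ≤ xi lam * |(traceTriple lam a j).2.1.derivative.eval E| := by
  have hξ := two_lt_xi hlam
  rcases bandState_traceTriple hlam ha hE k with ⟨_, _, _, h⟩ | h | ⟨_, _, _, h⟩
  · exact ⟨k, Or.inl rfl, by nlinarith [abs_nonneg ((traceTriple lam a k).2.1.derivative.eval E)]⟩
  -- The large trace `x_k` becomes the first trace of level `k + 1`, which leaves only the third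
  -- state there.
  · rcases bandState_traceTriple hlam ha hE (k + 1) with ⟨h', _⟩ | ⟨h', _⟩ | ⟨_, _, _, h'⟩
    · exact absurd h' (not_le.2 h.2.2.1)
    · exact absurd h' (not_le.2 h.2.2.1)
    · refine ⟨k + 1, Or.inr rfl, le_trans ?_ h'⟩
      exact pow_le_pow_right₀ (by linarith) (Nat.le_succ k)
  · exact ⟨k, Or.inl rfl, h⟩

/-! ### Sturmian windows and Christoffel words -/

/-- Write `qθ = c₀ + r`. The floor of `jβ + θ` is that of `(jP + c₀ + b_j) / q` with `b_j = ⌊r + jη⌋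
∈ {0, 1}`, and `b_j` matters only when `q ∣ jP + c₀ + 1`, that is for a single residue class `n₀` of
`j`. The constant `c` takes its value from `n₀`. -/
theorem exists_floor_eq {P : ℤ} {q : ℕ} (hq : 0 < q) (hcop : IsCoprime P q) {β θ η : ℝ}
    (hβ : q * β = P + η) (hη0 : 0 ≤ η) (hη : q * η < 1) (hθ : Int.fract θ + η < 1) :
    ∃ c : ℤ, ∀ j : ℕ, j ≤ q → ⌊j * β + θ⌋ = (j * P + c) / (q : ℤ) := by
  have hqZ : (0 : ℤ) < q := by exact_mod_cast hq
  have hqR : (0 : ℝ) < q := by exact_mod_cast hq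
  set c₀ := ⌊q * θ⌋ with hc₀
  set r := Int.fract (q * θ) with hr
  have hr0 : 0 ≤ r := Int.fract_nonneg _
  have hr1 : r < 1 := Int.fract_lt_one _
  have hqθ : q * θ = c₀ + r := (Int.floor_add_fract _).symm
  have hfl : ∀ j : ℕ, ⌊j * β + θ⌋ = (j * P + c₀ + ⌊r + j * η⌋) / (q : ℤ) := by
    intro j
    have e : j * β + θ = ((j * P + c₀ : ℤ) + (r + j * η)) / (q : ℝ) := by
      rw [eq_div_iff hqR.ne']
      push_cast
      linear_combination (j : ℝ) * hβ + hqθ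
    rw [e, Int.floor_div_natCast, Int.floor_intCast_add]
  have hb : ∀ j : ℕ, j ≤ q → ⌊r + j * η⌋ = 0 ∨ ⌊r + j * η⌋ = 1 := by
    intro j hj
    have h1 : (j : ℝ) * η ≤ q * η := by gcongr
    have h0 : 0 ≤ (j : ℝ) * η := by positivity
    have h2 : 0 ≤ ⌊r + j * η⌋ := Int.floor_nonneg.2 (by positivity)
    have h3 : ⌊r + j * η⌋ < 2 := Int.floor_lt.2 (by push_cast; linarith)
    omega
  have hsucc : ∀ N : ℤ, ¬ (q : ℤ) ∣ N + 1 → (N + 1) / (q : ℤ) = N / (q : ℤ) := by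
    intro N hN
    rw [Int.ediv_eq_iff_of_pos hqZ]
    have e1 := Int.emod_add_mul_ediv N q
    have e2 := Int.emod_nonneg N hqZ.ne'
    have e3 := Int.emod_lt_of_pos N hqZ
    have e4 : N % q + 1 ≠ q := fun h => hN ⟨N / q + 1, by rw [mul_add, mul_one]; omega⟩
    rw [mul_comm (N / (q : ℤ))]
    omega
  obtain ⟨n₀, hn₀q, hn₀⟩ : ∃ n₀ : ℕ, n₀ < q ∧ (q : ℤ) ∣ n₀ * P + c₀ + 1 := by
    obtain ⟨u, w, huw⟩ := hcop
    refine ⟨((-(c₀ + 1) * u) % q).toNat, ?_, ?_⟩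
    · have := Int.emod_lt_of_pos (-(c₀ + 1) * u) hqZ
      have := Int.emod_nonneg (-(c₀ + 1) * u) hqZ.ne'
      omega
    · rw [Int.toNat_of_nonneg (Int.emod_nonneg _ hqZ.ne')]
      have e1 := Int.emod_add_mul_ediv (-(c₀ + 1) * u) q
      refine ⟨-((-(c₀ + 1) * u) / q) * P + (c₀ + 1) * w, ?_⟩
      linear_combination P * e1 - (c₀ + 1) * huw
  refine ⟨c₀ + ⌊r + n₀ * η⌋, fun j hj => ?_⟩
  rw [hfl, ← add_assoc]
  by_cases hdvd : (q : ℤ) ∣ j * P + c₀ + 1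
  · have h1 : (q : ℤ) ∣ (j - n₀ : ℤ) := by
      refine hcop.symm.dvd_of_dvd_mul_right (z := P) ?_
      have := dvd_sub hdvd hn₀
      convert this using 1; ring
    by_cases hjn : j = n₀
    · rw [hjn]
    -- Only the two ends `0` and `q` of the window share a residue. The condition on `Int.fract θ`
    -- ensures that `b_j` agrees at both.
    · have h2 : j = q ∧ n₀ = 0 := by
        obtain ⟨m, hm⟩ := h1
        have hm1 : m < 2 := by
          by_contra hge
          nlinarith
        have hm2 : -1 < m := by
          by_contra hge
          nlinarith
        have : m = 0 ∨ m = 1 := by omega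
        rcases this with rfl | rfl
        · omega
        · omega
      obtain ⟨rfl, rfl⟩ := h2
      obtain ⟨m, hm⟩ := hn₀
      have hθe : θ = ((m - 1 : ℤ) : ℝ) + (j - 1 + r) / j := by
        field_simp
        have : (c₀ : ℝ) = j * m - 1 := by
          have := congrArg (Int.cast : ℤ → ℝ) hm
          push_cast at this
          linarith
        rw [mul_comm, hqθ, this]
        push_cast; ring
      have hj1 : (1 : ℝ) ≤ j := by exact_mod_cast hq
      have hfr : Int.fract θ = (j - 1 + r) / j := by
        rw [hθe, Int.fract_intCast_add, Int.fract_eq_self]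
        exact ⟨div_nonneg (by linarith) hqR.le, (div_lt_one hqR).2 (by linarith)⟩
      rw [hfr, div_add' _ _ _ hqR.ne', div_lt_one hqR] at hθ
      have z1 : ⌊r + j * η⌋ = 0 := Int.floor_eq_zero_iff.2 ⟨by positivity, by linarith⟩
      have z2 : ⌊r + ((0 : ℕ) : ℝ) * η⌋ = 0 :=
        Int.floor_eq_zero_iff.2 ⟨by simpa using hr0, by simpa using hr1⟩
      rw [z1, z2]
  · have hsame : ∀ b : ℤ, b = 0 ∨ b = 1 → (j * P + c₀ + b) / (q : ℤ) = (j * P + c₀) / (q : ℤ) := by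
      rintro b (rfl | rfl)
      · rw [add_zero]
      · exact hsucc _ hdvd
    rw [hsame _ (hb j hj), hsame _ (hb n₀ hn₀q.le)]

theorem v_eq_floor_sub {α : ℝ} (hα : α ∈ Set.Ioo (0 : ℝ) 1) (θ : ℝ) (n : ℤ) :
    v α θ n = ((⌊((n : ℝ) + 1) * α + θ⌋ - ⌊(n : ℝ) * α + θ⌋ : ℤ) : ℝ) := by
  have e : ((n : ℝ) + 1) * α + θ = (⌊(n : ℝ) * α + θ⌋ : ℝ) + (Int.fract ((n : ℝ) * α + θ) + α) := by
    have := Int.floor_add_fract ((n : ℝ) * α + θ)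
    linear_combination -this
  rw [e, Int.floor_intCast_add, add_sub_cancel_left, v]
  set F := Int.fract ((n : ℝ) * α + θ)
  have h0 : 0 ≤ F := Int.fract_nonneg _
  have h1 : F < 1 := Int.fract_lt_one _
  by_cases h : 1 - α ≤ F
  · rw [Set.indicator_of_mem (Set.mem_Ico.2 ⟨h, h1⟩)]
    have : ⌊F + α⌋ = 1 := Int.floor_eq_iff.2 ⟨by push_cast; linarith, by
      push_cast; linarith [hα.2]⟩
    rw [this]; simp
  · rw [Set.indicator_of_notMem fun hm => h hm.1]
    have : ⌊F + α⌋ = 0 := Int.floor_eq_zero_iff.2 ⟨by linarith [hα.1], by linarith⟩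
    rw [this]; simp

theorem v_add (α θ : ℝ) (m n : ℤ) : v α θ (m + n) = v α (θ + m * α) n := by
  unfold v
  congr 2
  push_cast; ring

/-- The trace of the transfer matrix over `v_{α,θ}(0), …, v_{α,θ}(q - 1)`. -/
def windowTrace (lam α θ : ℝ) (q : ℕ) : ℝ[X] :=
  (charMat (fun i => lam * v α θ i) q).trace

theorem christoffel_add_period (p : ℤ) {q : ℕ} (hq : 0 < q) (i : ℕ) :
    christoffel p q (i + q) = christoffel p q i := by
  have hqZ : (q : ℤ) ≠ 0 := by exact_mod_cast hq.ne'
  unfold christoffel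
  have e1 : (((i + q : ℕ) : ℤ) + 1) * p = (i + 1) * p + q * p := by push_cast; ring
  have e2 : ((i + q : ℕ) : ℤ) * p = i * p + q * p := by push_cast; ring
  rw [e1, e2, Int.add_mul_ediv_left _ _ hqZ, Int.add_mul_ediv_left _ _ hqZ]
  ring

/-- Solving `s p ≡ c` modulo `q` exhibits the window as the cyclic shift by `s` of the Christoffel
word. -/
theorem windowTrace_of_floor_eq {lam α θ : ℝ} (hα : α ∈ Set.Ioo (0 : ℝ) 1) {p c : ℤ} {q : ℕ}
    (hq : 0 < q) (hcop : IsCoprime p q)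
    (h : ∀ j : ℕ, j ≤ q → ⌊(j : ℝ) * α + θ⌋ = (j * p + c) / (q : ℤ)) :
    windowTrace lam α θ q = (christoffelMat lam p q).trace := by
  have hqZ : (0 : ℤ) < q := by exact_mod_cast hq
  obtain ⟨s, m, hs⟩ : ∃ (s : ℕ) (m : ℤ), (s : ℤ) * p = c + q * m := by
    obtain ⟨u, w, huw⟩ := hcop
    refine ⟨((c * u) % q).toNat, -((c * u) / q) * p - c * w, ?_⟩
    rw [Int.toNat_of_nonneg (Int.emod_nonneg _ hqZ.ne')]
    have e1 := Int.emod_add_mul_ediv (c * u) q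
    linear_combination p * e1 + c * huw
  rw [christoffelMat, ← trace_charMat_shift (fun i => by rw [christoffel_add_period p hq]) s,
    windowTrace]
  congr 1
  refine charMat_congr fun i hi => ?_
  rw [v_eq_floor_sub hα, christoffel]
  have e1 : (((s + i : ℕ) : ℤ) + 1) * p = ((i + 1 : ℕ) * p + c) + q * m := by
    push_cast; linear_combination hs
  have e2 : ((s + i : ℕ) : ℤ) * p = (i * p + c) + q * m := by push_cast; linear_combination hs
  have h1 := h i hi.le
  have h2 := h (i + 1) hi
  rw [e1, e2, Int.add_mul_ediv_left _ _ hqZ.ne', Int.add_mul_ediv_left _ _ hqZ.ne', ← h1, ← h2]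
  push_cast
  ring_nf

theorem fract_add_lt_or {α η : ℝ} (h1 : η ≤ α) (h2 : η ≤ 1 - α)
    (θ : ℝ) : Int.fract θ + η < 1 ∨ Int.fract (θ + α) + η < 1 := by
  by_contra! h
  have hf := Int.fract_lt_one θ
  have e : Int.fract (θ + α) = Int.fract θ + α - 1 := by
    rw [Int.fract_eq_iff]
    refine ⟨by linarith, by linarith, ⌊θ⌋ + 1, ?_⟩
    have := Int.floor_add_fract θ
    push_cast; linear_combination -this
  linarith

/-- The previous floor comparison fails only for phases near one end of the circle, and `θ` and `θ +
α` cannot both lie there. If `q α < p`, the window is read backwards, with slope `-α` from its right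
end. -/
theorem windowTrace_or {lam α : ℝ} (hα : α ∈ Set.Ioo (0 : ℝ) 1) {p : ℤ} {q : ℕ}
    (hq : 0 < q) (hcop : IsCoprime p q) (hη : q * |q * α - p| < 1) (h1 : |q * α - p| ≤ α)
    (h2 : |q * α - p| ≤ 1 - α) (θ : ℝ) :
    windowTrace lam α θ q = (christoffelMat lam p q).trace ∨
      windowTrace lam α (θ + α) q = (christoffelMat lam p q).trace := by
  have main : ∀ θ : ℝ,
      Int.fract (if 0 ≤ q * α - p then θ else θ + q * α) + |q * α - p| < 1 →
      windowTrace lam α θ q = (christoffelMat lam p q).trace := by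
    intro θ hθ
    split_ifs at hθ with h
    · rw [abs_of_nonneg h] at hη hθ
      obtain ⟨c, hc⟩ := exists_floor_eq hq hcop (β := α) (by ring) h hη hθ
      exact windowTrace_of_floor_eq hα hq hcop hc
    · push Not at h
      rw [abs_of_neg h] at hη hθ
      obtain ⟨c, hc⟩ := exists_floor_eq (P := -p) (β := -α) hq hcop.neg_left (by push_cast; ring)
        (by linarith) hη hθ
      refine windowTrace_of_floor_eq hα hq hcop (c := c - q * p) fun j hj => ?_
      have := hc (q - j) (Nat.sub_le _ _)
      rw [Nat.cast_sub hj] at this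
      rw [show (j : ℝ) * α + θ = ((q : ℝ) - j) * -α + (θ + q * α) by ring, this]
      congr 1
      rw [Nat.cast_sub hj]; ring
  split_ifs at main with h
  · exact (fract_add_lt_or h1 h2 θ).imp (main _) (main _)
  · refine (fract_add_lt_or h1 h2 (θ + q * α)).imp (main _) fun h' => main _ ?_
    rwa [add_right_comm]

/-! ### Convergents of the rotation number -/

theorem exists_partial_quotients {α : ℝ} (hα : α ∈ Set.Ioo (0 : ℝ) 1) (hirr : Irrational α) :
    ∃ a : ℕ → ℕ, (∀ k, 1 ≤ a k) ∧ ∀ k, q α k = cfDen a (k + 1) ∧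
      |cfDen a (k + 1) * α - cfNum a (k + 1)| * cfDen a (k + 2) ≤ 1 := by
  have hterm : ∀ n, ¬ (GenContFract.of α).TerminatedAt n := by
    intro n hn
    obtain ⟨r, hr⟩ := (GenContFract.terminates_iff_rat α).1 ⟨n, hn⟩
    exact hirr ⟨r, hr.symm⟩
  have hget : ∀ n, ∃ b : ℕ, 1 ≤ b ∧ (GenContFract.of α).s.get? n = some ⟨1, (b : ℝ)⟩ := by
    intro n
    obtain ⟨⟨ga, gb⟩, hgp⟩ := Option.ne_none_iff_exists'.1 (hterm n)
    obtain ⟨ha, z, hz⟩ := GenContFract.of_partNum_eq_one_and_exists_int_partDen_eq hgp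
    simp only at ha hz
    subst ha hz
    have h1 := GenContFract.of_one_le_get?_partDen (GenContFract.partDen_eq_s_b hgp)
    have hz1 : (1 : ℤ) ≤ z := by
      have h1 : (1 : ℝ) ≤ z := h1
      exact_mod_cast h1
    refine ⟨z.toNat, by omega, ?_⟩
    rw [hgp]
    have : ((z.toNat : ℕ) : ℝ) = z := by
      exact_mod_cast congrArg (Int.cast : ℤ → ℝ) (Int.toNat_of_nonneg (by omega : 0 ≤ z))
    rw [this]
  choose a ha hs using hget
  have hfloor : ⌊α⌋ = 0 := Int.floor_eq_zero_iff.2 ⟨hα.1.le, hα.2⟩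
  have hd : ∀ k, (GenContFract.of α).dens k = cfDen a (k + 1) ∧
      (GenContFract.of α).dens (k + 1) = cfDen a (k + 2) := by
    intro k
    induction k with
    | zero =>
      refine ⟨by simp [cfDen], ?_⟩
      rw [GenContFract.first_den_eq (hs 0)]; simp [cfDen]
    | succ k ih =>
      refine ⟨ih.2, ?_⟩
      rw [GenContFract.dens_recurrence (hs (k + 1)) ih.1 ih.2, show cfDen a (k + 1 + 2)
        = a (k + 1) * cfDen a (k + 2) + cfDen a (k + 1) from rfl]
      push_cast; ring
  have hn : ∀ k, (GenContFract.of α).nums k = cfNum a (k + 1) ∧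
      (GenContFract.of α).nums (k + 1) = cfNum a (k + 2) := by
    intro k
    induction k with
    | zero =>
      refine ⟨by simp [cfNum, hfloor], ?_⟩
      rw [GenContFract.first_num_eq (hs 0)]; simp [cfNum, hfloor]
    | succ k ih =>
      refine ⟨ih.2, ?_⟩
      rw [GenContFract.nums_recurrence (hs (k + 1)) ih.1 ih.2, show cfNum a (k + 1 + 2)
        = a (k + 1) * cfNum a (k + 2) + cfNum a (k + 1) from rfl]
      push_cast; ring
  refine ⟨a, ha, fun k => ⟨(hd k).1, ?_⟩⟩
  have h := GenContFract.abs_sub_convs_le (hterm k)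
  have p1 : (0 : ℝ) < cfDen a (k + 1) := by exact_mod_cast cfDen_pos ha k
  have p2 : (0 : ℝ) < cfDen a (k + 2) := by exact_mod_cast cfDen_pos ha (k + 1)
  rw [GenContFract.conv_eq_num_div_den, (hd k).1, (hd k).2, (hn k).1,
    le_div_iff₀ (by positivity)] at h
  calc _ = |(cfDen a (k + 1) : ℝ) * (α - cfNum a (k + 1) / cfDen a (k + 1))| * cfDen a (k + 2) := by
        congr 2; field_simp
    _ = _ := by rw [abs_mul, Nat.abs_cast]; ring
    _ ≤ 1 := h

theorem cf_isCoprime (a : ℕ → ℕ) (k : ℕ) : IsCoprime (cfNum a k) (cfDen a k) := by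
  rcases cf_det a k with h | h
  · exact ⟨-cfDen a (k + 1), cfNum a (k + 1), by linear_combination h⟩
  · exact ⟨cfDen a (k + 1), -cfNum a (k + 1), by linear_combination h⟩

theorem le_cfDen {a : ℕ → ℕ} (ha : ∀ k, 1 ≤ a k) (k : ℕ) : k ≤ cfDen a (k + 1) := by
  induction k using Nat.twoStepInduction with
  | zero => simp
  | one => exact cfDen_pos ha 1
  | more k ih1 ih2 =>
    have h1 := cfDen_pos ha k
    have h2 := Nat.le_mul_of_pos_left (cfDen a (k + 1 + 1)) (ha (k + 1))
    rw [show cfDen a (k + 2 + 1) = a (k + 1) * cfDen a (k + 1 + 1) + cfDen a (k + 1) from rfl]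
    omega

theorem cfDen_lt {a : ℕ → ℕ} (ha : ∀ k, 1 ≤ a k) (k : ℕ) :
    cfDen a (k + 2) < cfDen a (k + 3) := by
  have h1 := cfDen_pos ha k
  have h2 := Nat.le_mul_of_pos_left (cfDen a (k + 1 + 1)) (ha (k + 1))
  rw [show cfDen a (k + 3) = a (k + 1) * cfDen a (k + 1 + 1) + cfDen a (k + 1) from rfl]
  exact lt_of_le_of_lt h2 (Nat.lt_add_of_pos_right h1)

/-- Every phase has, up to one step, the trace of the convergent on windows of length `q_k`. -/
theorem exists_windowTrace {α : ℝ} (hα : α ∈ Set.Ioo (0 : ℝ) 1) {a : ℕ → ℕ}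
    (ha : ∀ k, 1 ≤ a k)
    (hd : ∀ k, |cfDen a (k + 1) * α - cfNum a (k + 1)| * cfDen a (k + 2) ≤ 1) :
    ∃ k₀ : ℕ, ∀ k, k₀ ≤ k → ∀ lam θ : ℝ,
      windowTrace lam α θ (cfDen a (k + 1)) = (traceTriple lam a k).2.1 ∨
        windowTrace lam α (θ + α) (cfDen a (k + 1)) = (traceTriple lam a k).2.1 := by
  have hμ : 0 < min α (1 - α) := lt_min hα.1 (by linarith [hα.2])
  obtain ⟨N, hN⟩ := exists_nat_gt (1 / min α (1 - α))
  refine ⟨N + 1, fun k hk lam θ => ?_⟩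
  rw [traceTriple_eq lam ha]
  -- Level 0 is avoided because `q_0 = q_1 = 1` may occur, whereas `q_k |q_k α - p_k| < 1` needs
  -- `q_k < q_{k+1}`.
  obtain ⟨j, rfl⟩ : ∃ j, k = j + 1 := ⟨k - 1, by omega⟩
  have hp1 : (0 : ℝ) < cfDen a (j + 1 + 1) := by exact_mod_cast cfDen_pos ha (j + 1)
  have hlt : (cfDen a (j + 1 + 1) : ℝ) < cfDen a (j + 1 + 2) := by exact_mod_cast cfDen_lt ha j
  have hdk := hd (j + 1)
  have hsmall : |cfDen a (j + 1 + 1) * α - cfNum a (j + 1 + 1)| ≤ min α (1 - α) := by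
    have h1 : (N : ℝ) ≤ cfDen a (j + 1 + 2) := by
      exact_mod_cast (show N ≤ j + 2 by omega).trans (le_cfDen ha (j + 1 + 1))
    have h2 : 1 < min α (1 - α) * cfDen a (j + 1 + 2) := by
      rw [div_lt_iff₀ hμ] at hN
      nlinarith
    by_contra hlt'
    push Not at hlt'
    have h3 : (0 : ℝ) < cfDen a (j + 1 + 2) := hp1.trans hlt
    have := mul_lt_mul_of_pos_right hlt' h3
    linarith
  refine windowTrace_or hα (cfDen_pos ha (j + 1)) (cf_isCoprime a _) ?_
    (hsmall.trans (min_le_left _ _)) (hsmall.trans (min_le_right _ _)) θ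
  rcases (abs_nonneg ((cfDen a (j + 1 + 1) : ℝ) * α - cfNum a (j + 1 + 1))).eq_or_lt with h0 | h0
  · rw [← h0]; simp
  · nlinarith

/-! ### Spectral gaps and periodic approximation -/

section SelfAdjoint

variable {F : Type*} [NormedAddCommGroup F] [InnerProductSpace ℂ F] [CompleteSpace F]

/-- `A²` is coercive, hence invertible, and therefore so is `A`. -/
theorem isUnit_of_isSelfAdjoint_of_le_norm {A : F →L[ℂ] F} (hA : IsSelfAdjoint A) {c : ℝ}
    (hc : 0 < c) (h : ∀ u, c * ‖u‖ ≤ ‖A u‖) : IsUnit A := by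
  have hsq : IsUnit (A * A) := by
    refine ContinuousLinearMap.isUnit_of_forall_le_norm_inner_map (A * A)
      (c := (c ^ 2).toNNReal) (Real.toNNReal_pos.2 (by positivity)) fun u => ?_
    have e : inner ℂ ((A * A) u) u = inner ℂ (A u) (A u) := by
      have := (ContinuousLinearMap.isSelfAdjoint_iff_isSymmetric.1 hA) (A u) u
      exact this
    rw [e, inner_self_eq_norm_sq_to_K]
    rw [norm_pow, Real.coe_toNNReal _ (by positivity), RCLike.norm_ofReal, abs_norm, ← mul_pow, mul_comm]
    exact pow_le_pow_left₀ (by positivity) (h u) 2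
  exact ((Commute.refl A).isUnit_mul_iff.1 hsq).1

/-- The inverse of `A - E` is self-adjoint, so its norm equals its spectral radius, at most `1 / δ`.
-/
theorem le_norm_sub_of_spectrum_gap {A : F →L[ℂ] F} (hA : IsSelfAdjoint A) {E δ : ℝ} (hδ : 0 < δ)
    (h : ∀ E' : ℝ, |E' - E| < δ → (E' : ℂ) ∉ spectrum ℂ A) (u : F) :
    δ * ‖u‖ ≤ ‖(A - algebraMap ℂ (F →L[ℂ] F) E) u‖ := by
  set B := A - algebraMap ℂ (F →L[ℂ] F) E with hB
  have hBsa : IsSelfAdjoint B := by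
    refine hA.sub ?_
    rw [IsSelfAdjoint, ← algebraMap_star_comm]
    simp
  have hspec : ∀ z ∈ spectrum ℂ B, δ ≤ ‖z‖ := by
    intro z hz
    have hzre := hBsa.mem_spectrum_eq_re hz
    by_contra hlt
    push Not at hlt
    refine h (z.re + E) ?_ ?_
    · rw [add_sub_cancel_right]; exact (Complex.abs_re_le_norm z).trans_lt hlt
    · rw [hB, ← spectrum.sub_singleton_eq] at hz
      obtain ⟨y, hy, e, he, rfl⟩ := hz
      simp only [Set.mem_singleton_iff] at he
      subst he
      have : ((((y - (E : ℂ)).re + E : ℝ)) : ℂ) = y := by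
        push_cast
        rw [← hzre]; ring
      simpa only [this] using hy
  have hunit : IsUnit B := by
    by_contra hn
    have : (0 : ℂ) ∈ spectrum ℂ B := by
      rw [spectrum.zero_mem_iff]; exact hn
    have := hspec 0 this
    rw [norm_zero] at this; linarith
  obtain ⟨U, hU⟩ := hunit
  have hinv : IsSelfAdjoint (↑U⁻¹ : F →L[ℂ] F) := by
    have h1 : star U = U := Units.ext (by rw [Units.coe_star, hU]; exact hBsa)
    rw [IsSelfAdjoint, ← Units.coe_star, star_inv, h1]
  have hnorm : ‖(↑U⁻¹ : F →L[ℂ] F)‖ ≤ δ⁻¹ := by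
    have h1 := hinv.spectralRadius_eq_nnnorm
    have h2 : spectralRadius ℂ (↑U⁻¹ : F →L[ℂ] F) ≤ ((δ⁻¹).toNNReal : ℝ≥0∞) := by
      refine iSup₂_le fun z hz => ?_
      rw [← spectrum.map_inv] at hz
      have h3 := hspec _ (hU ▸ Set.mem_inv.1 hz)
      rw [ENNReal.coe_le_coe, ← NNReal.coe_le_coe]
      rw [coe_nnnorm, Real.coe_toNNReal _ (by positivity)]
      rw [norm_inv] at h3
      exact le_inv_of_le_inv₀ hδ h3
    rw [h1, ENNReal.coe_le_coe, ← NNReal.coe_le_coe, Real.coe_toNNReal _ (by positivity)] at h2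
    exact h2
  have h4 : (↑U⁻¹ : F →L[ℂ] F) (B u) = u := by
    rw [← hU, ← mul_apply_eq_comp, Units.inv_mul, one_apply_eq_self]
  have h5 := (↑U⁻¹ : F →L[ℂ] F).le_of_opNorm_le hnorm (B u)
  rw [h4] at h5
  calc δ * ‖u‖ ≤ δ * (δ⁻¹ * ‖B u‖) := by gcongr
    _ = ‖B u‖ := by field_simp

end SelfAdjoint

/-- Multiplication by a bounded real sequence on `ℓ²(ℤ)`. -/
def mulOp (g : ℤ → ℝ) {K : ℝ} (hK : 0 ≤ K) (hg : ∀ n, |g n| ≤ K) : ℓ²(ℤ, ℂ) →L[ℂ] ℓ²(ℤ, ℂ) :=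
  lp.mapCLM 2 (fun n : ℤ => ((g n : ℝ) : ℂ) • ContinuousLinearMap.id ℂ ℂ) (K := K) hK (fun n => by
    rw [norm_smul, Complex.norm_real]
    simpa using hg n)

theorem mulOp_apply (g : ℤ → ℝ) {K : ℝ} (hK : 0 ≤ K) (hg : ∀ n, |g n| ≤ K) (u : ℓ²(ℤ, ℂ))
    (n : ℤ) : mulOp g hK hg u n = g n * u n := rfl

theorem reindex_apply (e : ℤ ≃ ℤ) (u : ℓ²(ℤ, ℂ)) (n : ℤ) : reindex e u n = u (e n) := rfl

theorem norm_reindex_le (e : ℤ ≃ ℤ) (u : ℓ²(ℤ, ℂ)) : ‖reindex e u‖ ≤ ‖u‖ := by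
  have := (reindex e).le_of_opNorm_le (LinearMap.mkContinuous_norm_le _ zero_le_one _) u
  rwa [one_mul] at this

/-- The discrete Schrödinger operator with potential `lam * w`. -/
def schrodinger (lam : ℝ) (w : ℤ → ℝ) (hw : ∀ n, |w n| ≤ 1) : ℓ²(ℤ, ℂ) →L[ℂ] ℓ²(ℤ, ℂ) :=
  reindex (Equiv.addRight 1) + reindex (Equiv.subRight 1) + (lam : ℂ) • mulOp w zero_le_one hw

theorem schrodinger_apply (lam : ℝ) (w : ℤ → ℝ) (hw : ∀ n, |w n| ≤ 1) (u : ℓ²(ℤ, ℂ)) (n : ℤ) :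
    schrodinger lam w hw u n = u (n + 1) + u (n - 1) + lam * w n * u n := by
  rw [mul_assoc]; rfl

theorem inner_reindex (e : ℤ ≃ ℤ) (u w : ℓ²(ℤ, ℂ)) :
    inner ℂ (reindex e u) w = inner ℂ u (reindex e.symm w) := by
  rw [lp.inner_eq_tsum, lp.inner_eq_tsum,
    ← e.tsum_eq fun n => inner ℂ (u n) (reindex e.symm w n)]
  simp [reindex_apply]

theorem isSelfAdjoint_schrodinger (lam : ℝ) (w : ℤ → ℝ) (hw : ∀ n, |w n| ≤ 1) :
    IsSelfAdjoint (schrodinger lam w hw) := by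
  rw [ContinuousLinearMap.isSelfAdjoint_iff_isSymmetric]
  intro x y
  have h1 : inner ℂ (mulOp w zero_le_one hw x) y = inner ℂ x (mulOp w zero_le_one hw y) := by
    rw [lp.inner_eq_tsum, lp.inner_eq_tsum]
    refine tsum_congr fun n => ?_
    simp only [mulOp_apply, RCLike.inner_apply, map_mul, Complex.conj_ofReal]
    ring
  have h2 : ∀ u, schrodinger lam w hw u = reindex (Equiv.addRight 1) u
    + reindex (Equiv.subRight 1) u + (lam : ℂ) • mulOp w zero_le_one hw u := fun _ => rfl
  have e1 : (Equiv.addRight (1 : ℤ)).symm = Equiv.subRight 1 := by ext; simp [sub_eq_add_neg]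
  have e2 : (Equiv.subRight (1 : ℤ)).symm = Equiv.addRight 1 := by ext; simp
  show inner ℂ (schrodinger lam w hw x) y = inner ℂ x (schrodinger lam w hw y)
  rw [h2, h2]
  simp only [inner_add_left, inner_add_right, inner_smul_left, inner_smul_right, h1,
    Complex.conj_ofReal, inner_reindex, e1, e2]
  ring

theorem abs_charMat_eval_le {lam E : ℝ} {w : ℕ → ℝ} (hw : ∀ n, |w n| ≤ 1) (n : ℕ)
    (i j : Fin 2) :
    |((charMat (fun i => lam * w i) n) i j).eval E| ≤ (|E| + |lam| + 1) ^ n := by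
  have h1 : 1 ≤ |E| + |lam| + 1 := by linarith [abs_nonneg E, abs_nonneg lam]
  induction n generalizing i with
  | zero => fin_cases i <;> fin_cases j <;> simp [charMat]
  | succ n ih =>
    have hc : |E - lam * w n| ≤ |E| + |lam| := by
      refine (abs_sub _ _).trans ?_
      rw [abs_mul]
      nlinarith [hw n, abs_nonneg lam]
    fin_cases i
    · simp only [charMat, stepMat, Matrix.mul_apply, Fin.sum_univ_two, Fin.zero_eta, Fin.isValue,
        Matrix.of_apply, Matrix.cons_val', Matrix.cons_val_zero, Matrix.cons_val_one,
        Matrix.cons_val_fin_one, eval_add, eval_mul, eval_sub, eval_X, eval_C, eval_neg, eval_one]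
      refine (abs_add_le _ _).trans ?_
      rw [abs_mul, abs_mul, pow_succ', add_mul _ (1 : ℝ)]
      refine add_le_add (mul_le_mul hc (ih 0) (abs_nonneg _) (by positivity)) ?_
      simpa using ih 1
    · have e : (charMat (fun i => lam * w i) (n + 1)) 1 j = (charMat (fun i => lam * w i) n) 0 j := by
        simp [charMat, stepMat, Matrix.mul_apply, Fin.sum_univ_two]
      show |((charMat (fun i => lam * w i) (n + 1)) 1 j).eval E| ≤ _
      rw [e]
      exact (ih 0).trans (pow_le_pow_right₀ h1 (Nat.le_succ n))

theorem trace_charMat_int_shift {w : ℤ → ℝ} {q : ℕ} (hq : 0 < q) (hper : ∀ n, w (n + q) = w n)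
    (lam : ℝ) (m n : ℤ) :
    (charMat (fun i => lam * w (m + i)) q).trace = (charMat (fun i => lam * w (n + i)) q).trace := by
  have hmul : ∀ (n k : ℤ), w (n + k * q) = w n := by
    have h : Function.Periodic w (q : ℤ) := hper
    intro n k
    simpa using h.int_mul k n
  have hqZ : (0 : ℤ) < q := by exact_mod_cast hq
  have key := trace_charMat_shift (w := fun i => lam * w (n + i)) (q := q)
    (fun i => by push_cast; rw [← add_assoc, hper]) ((m - n) % q).toNat
  rw [← key]
  congr 1
  refine charMat_congr fun i _ => ?_
  have e1 := Int.emod_add_mul_ediv (m - n) q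
  push_cast
  rw [Int.toNat_of_nonneg (Int.emod_nonneg _ hqZ.ne'), ← hmul _ (-((m - n) / q))]
  congr 2
  linear_combination -e1

/-- The values of a solution of the inhomogeneous equation after `j` steps, up to an error which
depends boundedly on the inhomogeneity. -/
theorem exists_variation_of_constants {lam : ℝ} {w : ℤ → ℝ} (hw : ∀ n, |w n| ≤ 1) (E : ℝ) (j : ℕ) :
    ∃ K : Fin 2 → ℓ²(ℤ, ℂ) →L[ℂ] ℓ²(ℤ, ℂ), ∀ (u f : ℓ²(ℤ, ℂ)),
      (∀ n, u (n + 1) = (E - lam * w n) * u n - u (n - 1) + f n) → ∀ (n : ℤ) (i : Fin 2),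
      u (n + j - (i : ℕ)) = ((charMat (fun l => lam * w (n + l)) j) i 0).eval E * u n
        + ((charMat (fun l => lam * w (n + l)) j) i 1).eval E * u (n - 1) + K i f n := by
  induction j with
  | zero =>
    refine ⟨fun _ => 0, fun u f h n => ?_⟩
    rw [Fin.forall_fin_two]
    constructor <;> simp [charMat]
  | succ j ih =>
    obtain ⟨K, hK⟩ := ih
    have hg : ∀ n, |E - lam * w (n + j)| ≤ |E| + |lam| := by
      intro n
      refine (abs_sub _ _).trans ?_
      rw [abs_mul]
      nlinarith [hw (n + j), abs_nonneg lam]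
    refine ⟨![mulOp (fun n => E - lam * w (n + j)) (by positivity) hg ∘L K 0 - K 1
      + reindex (Equiv.addRight (j : ℤ)), K 0], fun u f h n i => ?_⟩
    have h0 := hK u f h n 0
    have h1 := hK u f h n 1
    have hs := h (n + j)
    fin_cases i
    · have e1 : n + ((j + 1 : ℕ) : ℤ) - ((0 : ℕ) : ℤ) = n + j + 1 := by push_cast; ring
      have e2 : n + (j : ℤ) - ((1 : ℕ) : ℤ) = n + j - 1 := by push_cast; ring
      simp only [Fin.isValue, Fin.val_zero, Nat.cast_zero, sub_zero, Fin.val_one, e2] at h0 h1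
      show u (n + ((j + 1 : ℕ) : ℤ) - ((0 : ℕ) : ℤ)) =
        ((charMat (fun l => lam * w (n + l)) (j + 1)) 0 0).eval E * u n
        + ((charMat (fun l => lam * w (n + l)) (j + 1)) 0 1).eval E * u (n - 1)
        + ((mulOp (fun n => E - lam * w (n + j)) (by positivity) hg (K 0 f)) n - K 1 f n
          + reindex (Equiv.addRight (j : ℤ)) f n)
      rw [e1, hs, mulOp_apply, reindex_apply, h0, h1]
      simp only [charMat, stepMat, Matrix.mul_apply, Fin.sum_univ_two, Fin.isValue,
        Matrix.of_apply, Matrix.cons_val', Matrix.cons_val_zero, Matrix.cons_val_one,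
        Matrix.cons_val_fin_one, eval_add, eval_mul, eval_sub, eval_X, eval_C, eval_neg, eval_one,
        Equiv.coe_addRight]
      push_cast
      ring
    · have e1 : n + ((j + 1 : ℕ) : ℤ) - ((1 : ℕ) : ℤ) = n + j := by push_cast; ring
      simp only [Fin.isValue, Fin.val_zero, Nat.cast_zero, sub_zero] at h0
      show u (n + ((j + 1 : ℕ) : ℤ) - ((1 : ℕ) : ℤ)) =
        ((charMat (fun l => lam * w (n + l)) (j + 1)) 1 0).eval E * u n
        + ((charMat (fun l => lam * w (n + l)) (j + 1)) 1 1).eval E * u (n - 1) + K 0 f n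
      rw [e1, h0]
      simp [charMat, stepMat, Matrix.mul_apply, Fin.sum_univ_two]

/-- No Floquet theory is needed: by Cayley-Hamilton for the monodromy matrix, `u(n+q) + u(n-q) - τ
u(n)` is a bounded operator applied to `(H - E) u`. Both translations have norm at most 1, so `|τ| >
2` bounds `H - E` from below. -/
theorem notMem_spectrum_of_periodic {lam : ℝ} {w : ℤ → ℝ} (hw : ∀ n, |w n| ≤ 1) {q : ℕ}
    (hq : 0 < q) (hper : ∀ n, w (n + q) = w n) {E : ℝ} {m : ℤ}
    (hE : 2 < |(charMat (fun i => lam * w (m + i)) q).trace.eval E|) :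
    (E : ℂ) ∉ spectrum ℂ (schrodinger lam w hw) := by
  set τ := (charMat (fun i => lam * w (m + i)) q).trace.eval E with hτ
  set A : ℤ → Fin 2 → Fin 2 → ℝ :=
    fun n i j => ((charMat (fun l => lam * w (n + l)) q) i j).eval E with hA
  have hAtr : ∀ n, A n 0 0 + A n 1 1 = τ := by
    intro n
    rw [hτ, trace_charMat_int_shift hq hper lam m n, Matrix.trace_fin_two, eval_add]
  have hAdet : ∀ n, A n 0 0 * A n 1 1 - A n 0 1 * A n 1 0 = 1 := by
    intro n
    have := congrArg (eval E) (det_charMat (fun l => lam * w (n + l)) q)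
    rw [Matrix.det_fin_two] at this
    simpa using this
  have hAper : ∀ n i j, A (n - q) i j = A n i j := by
    intro n i j
    have : charMat (fun l => lam * w (n - q + l)) q = charMat (fun l => lam * w (n + l)) q := by
      refine charMat_congr fun l _ => ?_
      rw [← hper (n - q + l)]; ring_nf
    simp only [hA, this]
  have hAb : ∀ n i j, |A n i j| ≤ (|E| + |lam| + 1) ^ q := fun n i j =>
    abs_charMat_eval_le (fun l => hw (n + l)) q i j
  obtain ⟨K, hK⟩ := exists_variation_of_constants (lam := lam) hw E q
  have hc : 0 ≤ (|E| + |lam| + 1) ^ q := by positivity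
  set S := reindex (Equiv.addRight (q : ℤ))
  set S' := reindex (Equiv.subRight (q : ℤ))
  set R : ℓ²(ℤ, ℂ) →L[ℂ] ℓ²(ℤ, ℂ) := K 0
    - mulOp (fun n => A n 1 1) hc (fun n => hAb n 1 1) ∘L S' ∘L K 0
    + mulOp (fun n => A n 0 1) hc (fun n => hAb n 0 1) ∘L S' ∘L K 1 with hR
  set B := schrodinger lam w hw - algebraMap ℂ (ℓ²(ℤ, ℂ) →L[ℂ] ℓ²(ℤ, ℂ)) E with hB
  have key : ∀ u, S u + S' u - (τ : ℂ) • u = R (B u) := by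
    intro u
    have hrec : ∀ n, u (n + 1) = (E - lam * w n) * u n - u (n - 1) + B u n := by
      intro n
      have : B u n = schrodinger lam w hw u n - E * u n := rfl
      rw [this, schrodinger_apply]; ring
    ext n
    have h0 := hK u (B u) hrec n 0
    have h1 := hK u (B u) hrec (n - q) 0
    have h2 := hK u (B u) hrec (n - q) 1
    have e1 : (S u + S' u - (τ : ℂ) • u) n = u (n + q) + u (n - q) - τ * u n := rfl
    have e2 : R (B u) n = K 0 (B u) n - A n 1 1 * K 0 (B u) (n - q)
      + A n 0 1 * K 1 (B u) (n - q) := rfl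
    have a1 := hAper n 0 0
    have a2 := hAper n 0 1
    have a3 := hAper n 1 0
    have a4 := hAper n 1 1
    simp only [hA] at a1 a2 a3 a4
    rw [a1, a2] at h1
    rw [a3, a4] at h2
    simp only [Fin.isValue, Fin.val_zero, Nat.cast_zero, sub_zero, Fin.val_one, Nat.cast_one,
      sub_add_cancel] at h0 h1 h2
    have d := congrArg (Complex.ofReal) (hAdet n)
    have t := congrArg (Complex.ofReal) (hAtr n)
    simp only [hA] at d t
    push_cast at d t
    rw [e1, e2, h0]
    simp only [hA]
    linear_combination u n * t
      - ((((charMat (fun l => lam * w (n + l)) q) 1 1).eval E : ℝ) : ℂ) * h1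
      + ((((charMat (fun l => lam * w (n + l)) q) 0 1).eval E : ℝ) : ℂ) * h2 - u (n - q) * d
  have hsa : IsSelfAdjoint B := by
    refine (isSelfAdjoint_schrodinger lam w hw).sub ?_
    rw [IsSelfAdjoint, ← algebraMap_star_comm]
    simp
  have hlow : ∀ u, (|τ| - 2) * ‖u‖ ≤ ‖R‖ * ‖B u‖ := by
    intro u
    have h1 : ‖(τ : ℂ) • u‖ ≤ ‖S u‖ + ‖S' u‖ + ‖R (B u)‖ := by
      have : (τ : ℂ) • u = S u + S' u - R (B u) := by rw [← key]; abel
      rw [this]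
      exact (norm_sub_le _ _).trans (by gcongr; exact norm_add_le _ _)
    rw [norm_smul, Complex.norm_real, Real.norm_eq_abs] at h1
    have h2 : ‖S u‖ ≤ ‖u‖ := norm_reindex_le _ u
    have h3 : ‖S' u‖ ≤ ‖u‖ := norm_reindex_le _ u
    have h4 := R.le_opNorm (B u)
    linarith
  have hunit : IsUnit B := by
    have hR1 : 0 < ‖R‖ + 1 := by positivity
    refine isUnit_of_isSelfAdjoint_of_le_norm hsa (c := (|τ| - 2) / (‖R‖ + 1))
      (div_pos (by linarith) hR1) fun u => ?_
    rw [div_mul_eq_mul_div, div_le_iff₀ hR1]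
    nlinarith [hlow u, norm_nonneg (B u)]
  rw [spectrum.notMem_iff, ← IsUnit.neg_iff, neg_sub]
  exact hunit

theorem schrodinger_eq_H (lam α θ : ℝ) : schrodinger lam (v α θ) (abs_v_le_one α θ) = H lam α θ :=
  rfl

/-- A common spectral gap of operators which agree with `H` on growing windows is a gap of `H`. -/
theorem notMem_spectrum_of_approx {lam : ℝ} {w : ℤ → ℝ} (hw : ∀ n, |w n| ≤ 1) {E δ : ℝ}
    (hδ : 0 < δ)
    (h : ∀ N : ℕ, ∃ (w' : ℤ → ℝ) (hw' : ∀ n, |w' n| ≤ 1), (∀ n : ℤ, |n| ≤ N → w' n = w n) ∧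
      ∀ E' : ℝ, |E' - E| < δ → (E' : ℂ) ∉ spectrum ℂ (schrodinger lam w' hw')) :
    (E : ℂ) ∉ spectrum ℂ (schrodinger lam w hw) := by
  set B := schrodinger lam w hw - algebraMap ℂ (ℓ²(ℤ, ℂ) →L[ℂ] ℓ²(ℤ, ℂ)) E with hB
  have hsa : IsSelfAdjoint B := by
    refine (isSelfAdjoint_schrodinger lam w hw).sub ?_
    rw [IsSelfAdjoint, ← algebraMap_star_comm]
    simp
  have hfin : ∀ (u : ℓ²(ℤ, ℂ)) (N : ℕ), (∀ n : ℤ, N < |n| → u n = 0) → δ * ‖u‖ ≤ ‖B u‖ := by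
    intro u N hu
    obtain ⟨w', hw', heq, hgap⟩ := h N
    have h1 := le_norm_sub_of_spectrum_gap (isSelfAdjoint_schrodinger lam w' hw') hδ hgap u
    have : schrodinger lam w hw u = schrodinger lam w' hw' u := by
      ext n
      rw [schrodinger_apply, schrodinger_apply]
      by_cases hn : |n| ≤ N
      · rw [heq n hn]
      · rw [hu n (not_le.1 hn)]; simp
    rwa [sub_apply, ← this, ← sub_apply] at h1
  have hlow : ∀ u, δ * ‖u‖ ≤ ‖B u‖ := by
    intro u
    have hcl : IsClosed {u : ℓ²(ℤ, ℂ) | δ * ‖u‖ ≤ ‖B u‖} :=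
      isClosed_le (by fun_prop) (by fun_prop)
    -- Finitely supported sequences are dense, and the estimate is a closed condition.
    have hs := lp.hasSum_single (p := 2) (by norm_num) u
    refine hcl.mem_of_tendsto hs (Filter.Eventually.of_forall fun s => ?_)
    obtain ⟨N, hN⟩ : ∃ N : ℕ, ∀ n ∈ s, |n| ≤ N := by
      refine ⟨s.sup fun n => n.natAbs, fun n hn => ?_⟩
      rw [Int.abs_eq_natAbs]
      exact_mod_cast Finset.le_sup (f := fun n : ℤ => n.natAbs) hn
    refine hfin _ N fun n hn => ?_
    have hns : n ∉ s := fun hmem => absurd (hN n hmem) (not_le.2 hn)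
    rw [lp.coeFn_sum, Finset.sum_apply]
    refine Finset.sum_eq_zero fun i hi => ?_
    rw [lp.single_apply_ne]
    rintro rfl; exact hns hi
  have hunit := isUnit_of_isSelfAdjoint_of_le_norm hsa hδ hlow
  rw [spectrum.notMem_iff, ← IsUnit.neg_iff, neg_sub]
  exact hunit

/-! ### Escape under the trace map -/

/-- Since `|x| > 2`, `|x y_{n+1} - y_n| ≥ 2 |y_{n+1}| - |y_n|`, so moduli that do not decrease once
never decrease again. -/
theorem escape_chain {x u z : ℝ} (hx : 2 < |x|) (hu : 2 < |u|) (huz : |u| ≤ |z|)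
    (hxz : |x| ≤ |z|) (n : ℕ) :
    2 < |chain x u z n| ∧ |chain x u z n| ≤ |chain x u z (n + 1)| ∧
      |x| ≤ |chain x u z (n + 1)| := by
  induction n with
  | zero => exact ⟨hu, huz, hxz⟩
  | succ n ih =>
    obtain ⟨h1, h2, h3⟩ := ih
    have h4 : |chain x u z (n + 1)| ≤ |chain x u z (n + 2)| := by
      rw [chain]
      have := abs_sub_abs_le_abs_sub (x * chain x u z (n + 1)) (chain x u z n)
      rw [abs_mul] at this
      nlinarith
    exact ⟨h1.trans_le h2, h4, h3.trans h4⟩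

/-- The end of one escaping chain satisfies the hypotheses of `escape_chain` for the next level, so
escape propagates to all later levels. -/
theorem escape_traceTriple {lam E : ℝ} {a : ℕ → ℕ} {k n : ℕ} (hn : n < a k)
    (hx : 2 < |(traceTriple lam a k).2.1.eval E|) (ht : 2 < |(traceChain lam a k (n + 1)).eval E|)
    (h1 : |(traceTriple lam a k).2.1.eval E| < |(traceChain lam a k (n + 2)).eval E|)
    (h2 : |(traceChain lam a k (n + 1)).eval E| < |(traceChain lam a k (n + 2)).eval E|) (j : ℕ) :
    2 < |(traceTriple lam a (k + j)).2.1.eval E| := by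
  have hev : ∀ k n, (traceChain lam a k n).eval E = chain ((traceTriple lam a k).2.1.eval E)
      ((traceTriple lam a k).1.eval E) ((traceTriple lam a k).2.2.eval E) n := fun k n =>
    chain_map (evalRingHom E) _ _ _ n
  have hshift : ∀ m, chain ((traceTriple lam a k).2.1.eval E)
      ((traceChain lam a k (n + 1)).eval E) ((traceChain lam a k (n + 2)).eval E) m
      = (traceChain lam a k (n + 1 + m)).eval E := by
    intro m
    induction m using Nat.twoStepInduction with
    | zero => rfl
    | one => rfl
    | more m ih1 ih2 =>
      rw [chain, ih1, ih2, hev k (n + 1 + (m + 2)), show n + 1 + (m + 2) = n + 1 + m + 2 from rfl,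
        chain, ← hev, ← hev]
      rfl
  have key : ∀ j, 2 < |(traceTriple lam a (k + j)).2.1.eval E| ∧
      (2 < |(traceTriple lam a (k + j + 1)).2.1.eval E| ∧
        |(traceTriple lam a (k + j)).2.1.eval E| ≤ |(traceTriple lam a (k + j + 1)).2.2.eval E| ∧
        |(traceTriple lam a (k + j + 1)).2.1.eval E|
          ≤ |(traceTriple lam a (k + j + 1)).2.2.eval E|) := by
    intro j
    induction j with
    | zero =>
      refine ⟨hx, ?_⟩
      have := escape_chain hx ht h2.le h1.le (a k - (n + 1))
      rw [hshift, hshift, ← add_assoc, show n + 1 + (a k - (n + 1)) = a k by omega] at this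
      exact ⟨this.1, this.2.2, this.2.1⟩
    | succ j ih =>
      obtain ⟨g0, g1, g2, g3⟩ := ih
      refine ⟨g1, ?_⟩
      have := escape_chain g1 (u := (traceTriple lam a (k + j + 1)).1.eval E) g0 g2 g3
        (a (k + j + 1))
      rw [← hev, ← hev] at this
      exact ⟨this.1, this.2.2, this.2.1⟩
  exact (key j).1

/-- Periodic continuation of a window of length `q` starting at `m`. -/
def periodize (w : ℤ → ℝ) (m : ℤ) (q : ℕ) (n : ℤ) : ℝ := w (m + (n - m) % q)

theorem periodize_eq (w : ℤ → ℝ) {m n : ℤ} {q : ℕ} (h1 : m ≤ n) (h2 : n < m + q) :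
    periodize w m q n = w n := by
  rw [periodize, Int.emod_eq_of_lt (by omega) (by omega)]
  congr 1; ring

theorem periodize_add (w : ℤ → ℝ) (m : ℤ) (q : ℕ) (n : ℤ) :
    periodize w m q (n + q) = periodize w m q n := by
  rw [periodize, periodize, show n + q - m = n - m + q by ring, Int.add_emod_right]

/-- Energies in the spectrum do not escape under the trace map. -/
theorem noEscape_of_mem_Sigma {lam α : ℝ} {a : ℕ → ℕ} (ha : ∀ k, 1 ≤ a k) {k₀ : ℕ} (hk₀ : ∀ k, k₀ ≤ k → ∀ θ : ℝ,
      windowTrace lam α θ (cfDen a (k + 1)) = (traceTriple lam a k).2.1 ∨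
        windowTrace lam α (θ + α) (cfDen a (k + 1)) = (traceTriple lam a k).2.1)
    {E : ℝ} (hE : E ∈ Sigma lam α) : NoEscape lam a E := by
  intro k n hn hsm hx
  by_contra ht
  push Not at ht
  obtain ⟨θ, -, hspec⟩ := hE
  have hev : (traceChain lam a k (n + 2)).eval E = (traceTriple lam a k).2.1.eval E
      * (traceChain lam a k (n + 1)).eval E - (traceChain lam a k n).eval E := by
    simp [traceChain, chain]
  have hge : |(traceTriple lam a k).2.1.eval E| * |(traceChain lam a k (n + 1)).eval E| - 2
      ≤ |(traceChain lam a k (n + 2)).eval E| := by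
    rw [hev, ← abs_mul]
    exact (sub_le_sub_left hsm _).trans (abs_sub_abs_le_abs_sub _ _)
  have h1 : |(traceTriple lam a k).2.1.eval E| < |(traceChain lam a k (n + 2)).eval E| := by
    nlinarith
  have h2 : |(traceChain lam a k (n + 1)).eval E| < |(traceChain lam a k (n + 2)).eval E| := by
    nlinarith
  have hcont : ∀ P : ℝ[X], Continuous fun e : ℝ => |P.eval e| := fun P => P.continuous.abs
  have hopen : ∀ᶠ e in nhds E, 2 < |(traceTriple lam a k).2.1.eval e| ∧
      2 < |(traceChain lam a k (n + 1)).eval e| ∧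
      |(traceTriple lam a k).2.1.eval e| < |(traceChain lam a k (n + 2)).eval e| ∧
      |(traceChain lam a k (n + 1)).eval e| < |(traceChain lam a k (n + 2)).eval e| :=
    ((continuous_const.continuousAt.eventually_lt (hcont _).continuousAt hx).and
      ((continuous_const.continuousAt.eventually_lt (hcont _).continuousAt ht).and
      (((hcont _).continuousAt.eventually_lt (hcont _).continuousAt h1).and
      ((hcont _).continuousAt.eventually_lt (hcont _).continuousAt h2))))
  obtain ⟨δ, hδ, hball⟩ := Metric.eventually_nhds_iff.1 hopen
  rw [← schrodinger_eq_H] at hspec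
  refine notMem_spectrum_of_approx (abs_v_le_one α θ) hδ (fun N => ?_) hspec
  -- As `q_j ≥ j ≥ 2N + 2`, a window of length `q_j` starting at `-N - 1` or at `-N` covers `[-N,
  -- N]`; one of the two has trace `x_j`.
  set j := k + (k₀ + (2 * N + 2)) with hj
  have hq := le_cfDen ha j
  have hqpos := cfDen_pos ha j
  obtain ⟨m, hm1, hm2, hm⟩ : ∃ m : ℤ, m ≤ -N ∧ N < m + cfDen a (j + 1) ∧
      windowTrace lam α (θ + m * α) (cfDen a (j + 1)) = (traceTriple lam a j).2.1 := by
    rcases hk₀ j (by omega) (θ + ((-N - 1 : ℤ) : ℝ) * α) with h | h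
    · exact ⟨-N - 1, by omega, by omega, h⟩
    · refine ⟨-N, le_rfl, by omega, ?_⟩
      rw [← h]
      congr 1
      push_cast; ring
  refine ⟨periodize (v α θ) m (cfDen a (j + 1)), fun n => abs_v_le_one α θ _, fun n hn => ?_, ?_⟩
  · have := abs_le.1 hn
    exact periodize_eq _ (by omega) (by omega)
  · intro E' hE'
    obtain ⟨b1, b2, b3, b4⟩ := hball (y := E') (by rwa [Real.dist_eq])
    refine notMem_spectrum_of_periodic _ hqpos (periodize_add _ _ _) (m := m) ?_
    have : charMat (fun i => lam * periodize (v α θ) m (cfDen a (j + 1)) (m + i))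
        (cfDen a (j + 1)) = charMat (fun i => lam * v α (θ + m * α) i) (cfDen a (j + 1)) := by
      refine charMat_congr fun i hi => ?_
      rw [periodize_eq _ (by omega) (by omega), v_add]
    rw [this, ← windowTrace, hm]
    exact escape_traceTriple hn b1 b2 b3 b4 _

/-! ### Bounding trace derivatives by transfer-matrix norms -/

theorem abs_le_opNorm (A : Matrix (Fin 2) (Fin 2) ℝ) (i j : Fin 2) : |A i j| ≤ opNorm A := by
  have h1 := (Matrix.toEuclideanCLM (𝕜 := ℝ) A).le_opNorm (EuclideanSpace.single j 1)
  rw [PiLp.norm_single, norm_one, mul_one] at h1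
  have h2 := PiLp.norm_apply_le (Matrix.toEuclideanCLM (𝕜 := ℝ) A (EuclideanSpace.single j 1)) i
  have h3 : (Matrix.toEuclideanCLM (𝕜 := ℝ) A (EuclideanSpace.single j 1)) i = A i j := by
    rw [Matrix.ofLp_toEuclideanCLM]
    simp
  rw [h3] at h2
  exact h2.trans h1

theorem opNorm_one : opNorm 1 = 1 := by
  rw [opNorm, map_one, norm_one]

/-- The derivative of the trace is controlled by the norms of the partial products. -/
theorem abs_derivative_trace_le {w m : ℕ → ℝ} {E : ℝ}
    (hm : ∀ n i j, |(charMat w n i j).eval E| ≤ m n) (n : ℕ) :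
    |(charMat w n).trace.derivative.eval E|
      ≤ 4 * m n * ∑ l ∈ Finset.range n, m (l + 1) * m l := by
  have hm0 : ∀ n, 0 ≤ m n := fun n => (abs_nonneg _).trans (hm n 0 0)
  set A : ℕ → Matrix (Fin 2) (Fin 2) ℝ := fun n => (charMat w n).map (eval E) with hA
  set D : ℕ → Matrix (Fin 2) (Fin 2) ℝ := fun n => (charMat w n).map (fun P => P.derivative.eval E)
    with hD
  set T' : ℕ → Matrix (Fin 2) (Fin 2) ℝ := fun n => !![E - w n, -1; 1, 0] with hT
  set P : Matrix (Fin 2) (Fin 2) ℝ := !![1, 0; 0, 0] with hP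
  have hAs : ∀ n, A (n + 1) = T' n * A n := by
    intro n
    ext i j
    fin_cases i <;> simp [hA, hT, charMat, stepMat, Matrix.mul_apply, Fin.sum_univ_two]
  have hDs : ∀ n, D (n + 1) = T' n * D n + P * A n := by
    intro n
    ext i j
    fin_cases i <;>
      simp [hD, hA, hT, hP, charMat, stepMat, Matrix.mul_apply, Fin.sum_univ_two,
        -Matrix.cons_mul]
    ring
  have hTdet : ∀ n, (T' n).det = 1 := fun n => by simp [hT, Matrix.det_fin_two]
  have hAdet : ∀ n, (A n).det = 1 := by
    intro n
    induction n with
    | zero => simp [hA, charMat]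
    | succ n ih => rw [hAs, Matrix.det_mul, ih, hTdet, one_mul]
  have hAadj : ∀ n i j, |(A n).adjugate i j| ≤ m n := by
    intro n i j
    rw [Matrix.adjugate_fin_two]
    fin_cases i <;> fin_cases j <;> simp [hA, hm]
  -- `A_n⁻¹ D_n` telescopes, with increments `A_{n+1}⁻¹ P A_n`.
  have hG : ∀ n i j, |((A n).adjugate * D n) i j| ≤ ∑ l ∈ Finset.range n, m (l + 1) * m l := by
    intro n
    induction n with
    | zero => intro i j; fin_cases i <;> fin_cases j <;> simp [hD, charMat, Matrix.mul_apply]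
    | succ n ih =>
      intro i j
      have e : (A (n + 1)).adjugate * D (n + 1)
          = (A n).adjugate * D n + (A (n + 1)).adjugate * P * A n := by
        rw [hDs, mul_add, ← mul_assoc, ← mul_assoc, hAs, Matrix.adjugate_mul_distrib,
          mul_assoc (A n).adjugate _ (T' n), Matrix.adjugate_mul, hTdet, one_smul, mul_one]
      have e2 : ((A (n + 1)).adjugate * P * A n) i j
          = (A (n + 1)).adjugate i 0 * A n 0 j := by
        simp [hP, Matrix.mul_apply, Fin.sum_univ_two, -Matrix.cons_mul]
      rw [e, Matrix.add_apply, e2, Finset.sum_range_succ]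
      refine (abs_add_le _ _).trans (add_le_add (ih i j) ?_)
      rw [abs_mul]
      exact mul_le_mul (hAadj _ _ _) (hm n 0 j) (abs_nonneg _) (hm0 _)
  set S := ∑ l ∈ Finset.range n, m (l + 1) * m l
  have htr : (charMat w n).trace.derivative.eval E = (D n).trace := by
    simp [hD, Matrix.trace_fin_two]
  have hDG : D n = A n * ((A n).adjugate * D n) := by
    rw [← mul_assoc, Matrix.mul_adjugate, hAdet, one_smul, one_mul]
  have hterm : ∀ i j, |A n i j * ((A n).adjugate * D n) j i| ≤ m n * S := fun i j => by
    rw [abs_mul]; exact mul_le_mul (hm n i j) (hG n j i) (abs_nonneg _) (hm0 n)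
  rw [htr, hDG, Matrix.trace_fin_two, Matrix.mul_apply, Matrix.mul_apply, Fin.sum_univ_two,
    Fin.sum_univ_two]
  have h00 := abs_le.1 (hterm 0 0)
  have h01 := abs_le.1 (hterm 0 1)
  have h10 := abs_le.1 (hterm 1 0)
  have h11 := abs_le.1 (hterm 1 1)
  rw [abs_le]
  constructor <;> linarith

theorem abs_charMat_tail_le {w m : ℕ → ℝ} {E κ : ℝ} (hκ : |E| + |w 0| + 1 ≤ κ)
    (hm : ∀ n i j, |(charMat w n i j).eval E| ≤ m n) (n : ℕ) (i j : Fin 2) :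
    |(charMat (fun l => w (l + 1)) n i j).eval E| ≤ κ * m (n + 1) := by
  have h0 : 0 ≤ m (n + 1) := (abs_nonneg _).trans (hm (n + 1) 0 0)
  have e : charMat (fun l => w (l + 1)) n = charMat w (n + 1) * (stepMat (w 0)).adjugate := by
    rw [charMat_succ', mul_assoc, Matrix.mul_adjugate, det_stepMat, one_smul, mul_one]
  have g0 := hm (n + 1) i 0
  have g1 := hm (n + 1) i 1
  have hE := abs_nonneg E
  have hw := abs_nonneg (w 0)
  rw [e, Matrix.adjugate_fin_two]
  fin_cases j
  · have : ((charMat w (n + 1) * !![stepMat (w 0) 1 1, -stepMat (w 0) 0 1; -stepMat (w 0) 1 0,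
        stepMat (w 0) 0 0]) i 0).eval E = -(charMat w (n + 1) i 1).eval E := by
      simp [Matrix.mul_apply, Fin.sum_univ_two, stepMat]
    simp only [Fin.zero_eta]
    rw [this, abs_neg]
    nlinarith
  · have : ((charMat w (n + 1) * !![stepMat (w 0) 1 1, -stepMat (w 0) 0 1; -stepMat (w 0) 1 0,
        stepMat (w 0) 0 0]) i 1).eval E
        = (charMat w (n + 1) i 0).eval E + (charMat w (n + 1) i 1).eval E * (E - w 0) := by
      simp [Matrix.mul_apply, Fin.sum_univ_two, stepMat]
    simp only [Fin.mk_one]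
    rw [this]
    refine (abs_add_le _ _).trans ?_
    rw [abs_mul]
    have h3 : |E - w 0| ≤ |E| + |w 0| := abs_sub _ _
    have h4 := mul_le_mul g1 h3 (abs_nonneg _) h0
    nlinarith

/-- By Cauchy-Schwarz in the form `ab ≤ (a² + b²) / 2`, the sum of products is at most `2S`, and the
remaining factor is at most `√S`. A window shifted by one site costs a factor `κ` in each of the
three norms and requires the term `n = q + 1`. -/
theorem abs_derivative_le_of_window {w m : ℕ → ℝ} {E κ : ℝ} (hκ : |E| + |w 0| + 1 ≤ κ)
    (hm : ∀ n i j, |(charMat w n i j).eval E| ≤ m n) (hm0 : m 0 = 1) {X : ℝ[X]} {q N : ℕ}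
    (hX : (charMat w q).trace = X ∨ (charMat (fun l => w (l + 1)) q).trace = X)
    (hq : 0 < q) (hqN : q + 1 ≤ N) :
    |X.derivative.eval E| ≤ 8 * κ ^ 3 * √(∑ n ∈ Finset.Icc 1 N, m n ^ 2) ^ 3 := by
  set S := ∑ n ∈ Finset.Icc 1 N, m n ^ 2 with hS
  have hmnn : ∀ n, 0 ≤ m n := fun n => (abs_nonneg _).trans (hm n 0 0)
  have hκ1 : 1 ≤ κ := by linarith [abs_nonneg E, abs_nonneg (w 0)]
  have hm1 : 1 ≤ m 1 := by
    have := hm 1 1 0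
    simpa [charMat, stepMat] using this
  have hmem : ∀ n, 1 ≤ n → n ≤ N → m n ^ 2 ≤ S := fun n h1 h2 =>
    Finset.single_le_sum (f := fun n => m n ^ 2) (fun _ _ => sq_nonneg _) (Finset.mem_Icc.2 ⟨h1, h2⟩)
  have hS1 : 1 ≤ S := by nlinarith [hmem 1 le_rfl (by omega)]
  have hsum1 : ∀ c, c + q ≤ N → ∑ l ∈ Finset.range q, m (l + 1 + c) ^ 2 ≤ S := by
    intro c hc
    have e : ∑ l ∈ Finset.range q, m (l + 1 + c) ^ 2
        = ∑ n ∈ (Finset.range q).image (fun l => l + 1 + c), m n ^ 2 := by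
      rw [Finset.sum_image]
      intro x _ y _ hxy
      simp only at hxy
      omega
    rw [e]
    refine Finset.sum_le_sum_of_subset_of_nonneg ?_ fun _ _ _ => sq_nonneg _
    intro n hn
    obtain ⟨l, hl, rfl⟩ := Finset.mem_image.1 hn
    rw [Finset.mem_range] at hl
    exact Finset.mem_Icc.2 ⟨by omega, by omega⟩
  have hsum0 : ∑ l ∈ Finset.range q, m l ^ 2 ≤ 2 * S := by
    obtain ⟨r, rfl⟩ : ∃ r, q = r + 1 := ⟨q - 1, by omega⟩
    rw [Finset.sum_range_succ']
    have h1 : ∑ l ∈ Finset.range r, m (l + 1) ^ 2 ≤ ∑ l ∈ Finset.range (r + 1), m (l + 1) ^ 2 := by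
      rw [Finset.sum_range_succ]; linarith [sq_nonneg (m (r + 1))]
    have h2 := hsum1 0 (by omega)
    simp only [add_zero] at h2
    rw [hm0]; linarith
  have hprod : ∀ o, o = 0 ∨ o = 1 →
      ∑ l ∈ Finset.range q, m (l + 1 + o) * m (l + o) ≤ 2 * S := by
    intro o ho
    have h1 : ∑ l ∈ Finset.range q, m (l + 1 + o) * m (l + o)
        ≤ ∑ l ∈ Finset.range q, (m (l + 1 + o) ^ 2 + m (l + o) ^ 2) / 2 :=
      Finset.sum_le_sum fun l _ => by nlinarith [sq_nonneg (m (l + 1 + o) - m (l + o))]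
    rw [← Finset.sum_div, Finset.sum_add_distrib] at h1
    have h2 := hsum1 o (by omega)
    rcases ho with rfl | rfl
    · simp only [add_zero] at h1 h2 ⊢; linarith
    · have h3 := hsum1 0 (by omega)
      simp only [add_zero] at h3
      linarith
  have hsq : √S ^ 2 = S := Real.sq_sqrt (by linarith)
  have hroot : ∀ n, 1 ≤ n → n ≤ N → m n ≤ √S := fun n h1 h2 => Real.le_sqrt_of_sq_le (hmem n h1 h2)
  have hfin : ∀ (o : ℕ) (c : ℝ), o = 0 ∨ o = 1 → 0 ≤ c → c ≤ κ →
      4 * (c * m (q + o)) * ∑ l ∈ Finset.range q, (c * m (l + 1 + o)) * (c * m (l + o))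
        ≤ 8 * κ ^ 3 * √S ^ 3 := by
    intro o c ho hc0 hc
    have e : ∑ l ∈ Finset.range q, (c * m (l + 1 + o)) * (c * m (l + o))
        = c ^ 2 * ∑ l ∈ Finset.range q, m (l + 1 + o) * m (l + o) := by
      rw [Finset.mul_sum]; exact Finset.sum_congr rfl fun l _ => by ring
    rw [e]
    have hnn : 0 ≤ ∑ l ∈ Finset.range q, m (l + 1 + o) * m (l + o) :=
      Finset.sum_nonneg fun l _ => mul_nonneg (hmnn _) (hmnn _)
    have h1 := hroot (q + o) (by omega) (by omega)
    have h2 := hprod o ho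
    have h3 := hmnn (q + o)
    have h4 : √S * S = √S ^ 3 := by rw [pow_succ' (√S) 2, hsq]
    calc _ ≤ 4 * (κ * √S) * (κ ^ 2 * (2 * S)) := by gcongr
      _ = 8 * κ ^ 3 * (√S * S) := by ring
      _ = 8 * κ ^ 3 * √S ^ 3 := by rw [h4]
  rcases hX with rfl | rfl
  · refine (abs_derivative_trace_le hm q).trans ?_
    simpa using hfin 0 1 (Or.inl rfl) zero_le_one hκ1
  · refine (abs_derivative_trace_le (abs_charMat_tail_le hκ hm) q).trans ?_
    exact hfin 1 κ (Or.inr rfl) (by linarith) le_rfl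

theorem Mpos_apply (E lam α θ : ℝ) (n : ℕ) (i j : Fin 2) :
    Mpos E lam α θ n i j = (charMat (fun l => lam * v α θ (l + 1)) n i j).eval E := by
  induction n generalizing i with
  | zero => fin_cases i <;> fin_cases j <;> simp [Mpos, charMat]
  | succ n ih =>
    fin_cases i <;>
      simp [Mpos, charMat, T, stepMat, Matrix.mul_apply, Fin.sum_univ_two, ih]

theorem T_inv (E lam α θ : ℝ) (m : ℤ) :
    (T E m lam α θ)⁻¹ = swapMat ℝ * T E m lam α θ * swapMat ℝ := by
  refine Matrix.inv_eq_left_inv ?_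
  ext i j
  fin_cases i <;> fin_cases j <;> simp [swapMat, T, Matrix.mul_apply, Fin.sum_univ_two]

theorem swapMat_Mneg_swapMat_apply (E lam α θ : ℝ) (n : ℕ) (i j : Fin 2) :
    (swapMat ℝ * Mneg E lam α θ n * swapMat ℝ) i j
      = (charMat (fun l => lam * v α θ (-l)) n i j).eval E := by
  induction n generalizing i with
  | zero =>
    rw [Mneg, mul_one, swapMat_mul_self]
    fin_cases i <;> fin_cases j <;> simp [charMat]
  | succ n ih =>
    have e : swapMat ℝ * Mneg E lam α θ (n + 1) * swapMat ℝ
        = T E (-n) lam α θ * (swapMat ℝ * Mneg E lam α θ n * swapMat ℝ) := by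
      rw [Mneg, T_inv]
      calc _ = (swapMat ℝ * swapMat ℝ) * T E (-n) lam α θ
            * (swapMat ℝ * Mneg E lam α θ n * swapMat ℝ) := by simp only [mul_assoc]
        _ = _ := by rw [swapMat_mul_self, one_mul]
    rw [e, Matrix.mul_apply, Fin.sum_univ_two, ih, ih]
    fin_cases i <;> simp [charMat, T, stepMat, Matrix.mul_apply, Fin.sum_univ_two]

theorem abs_swap_le_opNorm (A : Matrix (Fin 2) (Fin 2) ℝ) (i j : Fin 2) :
    |(swapMat ℝ * A * swapMat ℝ) i j| ≤ opNorm A := by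
  fin_cases i <;> fin_cases j <;>
    simp [swapMat, Matrix.mul_apply, Fin.sum_univ_two, abs_le_opNorm, -Matrix.cons_mul]

theorem M_natCast (E lam α θ : ℝ) (n : ℕ) : M E n lam α θ = Mpos E lam α θ n := by
  simp [M]

theorem M_neg_natCast (E lam α θ : ℝ) (n : ℕ) : M E (-n) lam α θ = Mneg E lam α θ n := by
  rcases Nat.eq_zero_or_pos n with rfl | hn
  · simp [M, Mpos, Mneg]
  · rw [M, if_neg (by omega)]; simp

/-- The sum of squares of norms dominates the derivative of every trace of a convergent whose
windows fit into it. -/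
theorem abs_derivative_le_avgNorm {lam α θ E L κ : ℝ} (hlam : 0 ≤ lam)
    (hκ : |E| + lam + 1 ≤ κ) {q : ℕ} (hq : 0 < q) {X : ℝ[X]}
    (hX : ∀ θ : ℝ, windowTrace lam α θ q = X ∨ windowTrace lam α (θ + α) q = X)
    (hL : (q : ℝ) + 2 ≤ |L|) :
    |X.derivative.eval E| ≤ 8 * κ ^ 3 * avgNorm E lam α θ L ^ 3 := by
  have hN : q + 1 ≤ ⌊|L|⌋₊ - 1 := by
    have : q + 2 ≤ ⌊|L|⌋₊ := Nat.le_floor (by push_cast; exact hL)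
    omega
  have hκ1 : 0 ≤ κ := by linarith [abs_nonneg E]
  have hκ' : ∀ n, |E| + |lam * v α θ n| + 1 ≤ κ := by
    intro n
    rw [abs_mul, abs_of_nonneg hlam]
    nlinarith [abs_v_le_one α θ n]
  suffices h : ∃ s : ℤ, s = (if 0 ≤ L then 1 else -1) ∧ |X.derivative.eval E| ≤ 8 * κ ^ 3 *
      √(∑ n ∈ Finset.Icc 1 (⌊|L|⌋₊ - 1), opNorm (M E (s * (n : ℤ)) lam α θ) ^ 2) ^ 3 by
    obtain ⟨s, hs, h⟩ := h
    refine h.trans ?_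
    subst hs
    unfold avgNorm
    simp only
    have hfl : 0 ≤ |L| - (⌊|L|⌋₊ : ℝ) := sub_nonneg.2 (Nat.floor_le (abs_nonneg L))
    gcongr
    exact le_add_of_nonneg_right (mul_nonneg hfl (sq_nonneg _))
  by_cases hL0 : 0 ≤ L
  · refine ⟨1, by rw [if_pos hL0], ?_⟩
    refine abs_derivative_le_of_window (w := fun l => lam * v α θ (l + 1))
      (m := fun n => opNorm (M E (1 * (n : ℤ)) lam α θ)) (q := q) (hκ' _) (fun n i j => ?_) ?_ ?_
      hq hN
    · rw [← Mpos_apply, one_mul, M_natCast]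
      exact abs_le_opNorm _ _ _
    · simp [M, Mpos, opNorm_one]
    · have e1 : ∀ l : ℕ, v α θ (l + 1) = v α (θ + α) l := fun l => by
        rw [add_comm, v_add]; simp
      have e2 : ∀ l : ℕ, v α θ (((l + 1 : ℕ) : ℤ) + 1) = v α (θ + α + α) l := fun l => by
        rw [show ((l + 1 : ℕ) : ℤ) + 1 = 2 + l by push_cast; ring, v_add]
        congr 1; push_cast; ring
      have := hX (θ + α)
      simp only [windowTrace, ← e1, ← e2] at this
      exact this
  · refine ⟨-1, by rw [if_neg hL0], ?_⟩
    refine abs_derivative_le_of_window (w := fun l => lam * v α θ (-l))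
      (m := fun n => opNorm (M E (-1 * (n : ℤ)) lam α θ)) (q := q) (hκ' _) (fun n i j => ?_) ?_ ?_
      hq hN
    · rw [← swapMat_Mneg_swapMat_apply, neg_one_mul, M_neg_natCast]
      exact abs_swap_le_opNorm _ _ _
    · simp [M, Mpos, opNorm_one]
    -- On the left half-line the sites are read as `0, -1, …`; reversal turns these windows into
    -- ordinary ones starting at `1 - q` and `-q`.
    · rw [← trace_charMat_reverse, ← trace_charMat_reverse (fun l => lam * v α θ (-(l + 1 : ℕ)))]
      have e1 : charMat (fun i => lam * v α θ (-((q - 1 - i : ℕ) : ℤ))) q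
          = charMat (fun i => lam * v α (θ + -q * α + α) i) q := by
        refine charMat_congr fun i hi => ?_
        rw [show -((q - 1 - i : ℕ) : ℤ) = (-q + 1) + i by omega, v_add]
        congr 2; push_cast; ring
      have e2 : charMat (fun i => lam * v α θ (-((q - 1 - i + 1 : ℕ) : ℤ))) q
          = charMat (fun i => lam * v α (θ + -q * α) i) q := by
        refine charMat_congr fun i hi => ?_
        rw [show -((q - 1 - i + 1 : ℕ) : ℤ) = -q + i by omega, v_add]
        congr 2; push_cast; ring
      rw [e1, e2]
      exact (hX (θ + -q * α)).symm

/-! ### The power law -/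

theorem IsGrowthBound.two_le {α B : ℝ} (hα : α ∈ Set.Ioo (0 : ℝ) 1) (hirr : Irrational α)
    (hB : IsGrowthBound α B) : 2 ≤ B := by
  obtain ⟨a, ha, hq⟩ := exists_partial_quotients hα hirr
  have h1 := hB 1 le_rfl
  rw [(hq 1).1, pow_one] at h1
  have : (1 : ℝ) ≤ cfDen a (1 + 1) := by exact_mod_cast cfDen_pos ha 1
  linarith

theorem powerLawBound_of_rpow_le {lam α B ζ : ℝ} (hlam : 20 < lam) (hα : α ∈ Set.Ioo (0 : ℝ) 1)
    (hirr : Irrational α) (hB : IsGrowthBound α B) (hζ : 0 < ζ) (hζB : (B ^ ζ) ^ 3 ≤ xi lam) :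
    ∃ C : ℝ, 0 < C ∧ PowerLawBound lam α C ζ := by
  obtain ⟨a, ha, hq⟩ := exists_partial_quotients hα hirr
  obtain ⟨k₀, hk₀⟩ := exists_windowTrace hα ha fun k => (hq k).2
  have hB2 := hB.two_le hα hirr
  have hξ := two_lt_xi hlam
  set κ := 2 * lam + 3 with hκ
  have hκ1 : 1 ≤ κ := by linarith
  set c := 8 * xi lam * κ with hc
  have hc0 : 0 < c := by positivity
  have hβ : 0 < B ^ ζ := Real.rpow_pos_of_pos (by linarith) _
  -- `|L|` lies between `B ^ (k + 3)` and `B ^ (k + 4)`, while the derivative bound has exponent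
  -- `k`; this accounts for the fourth power. The threshold makes `k > k₀`. It does not depend on
  -- the phase.
  refine ⟨1 / ((B ^ ζ) ^ 4 * c), by positivity, fun θ _ => ⟨B ^ (k₀ + 4), fun E hE L hL => ?_⟩⟩
  have hNE := noEscape_of_mem_Sigma ha (fun k hk θ => hk₀ k hk lam θ) hE
  have hEb := abs_le_of_noEscape hlam ha hNE
  obtain ⟨n, hn1, hn2⟩ := exists_nat_pow_near (x := |L|) (y := B)
    ((one_le_pow₀ (by linarith)).trans hL) (by linarith)
  have hnk : k₀ + 4 < n + 1 := (pow_lt_pow_iff_right₀ (by linarith)).1 (hL.trans_lt hn2)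
  obtain ⟨k, rfl⟩ : ∃ k, n = k + 3 := ⟨n - 3, by omega⟩
  obtain ⟨j, hj, hder⟩ := exists_le_derivative hlam ha hNE k
  -- `q_j + 1 ≤ B ^ (k + 1)`, and the two spare powers of `B ≥ 2` absorb the missing site.
  have hjL : (cfDen a (j + 1) : ℝ) + 2 ≤ |L| := by
    have h1 := hB j (by omega)
    rw [(hq j).1] at h1
    have h2 : B ^ j ≤ B ^ (k + 1) := pow_le_pow_right₀ (by linarith) (by omega)
    have h3 : 1 ≤ B ^ (k + 1) := one_le_pow₀ (by linarith)
    have h4 : B ^ (k + 3) = B ^ (k + 1) * B ^ 2 := by ring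
    have h5 : 4 ≤ B ^ 2 := by nlinarith
    nlinarith
  have hbound := abs_derivative_le_avgNorm (E := E) (θ := θ) (κ := κ) (by linarith) (by linarith)
    (cfDen_pos ha j) (hk₀ j (by omega) lam) hjL
  set R := avgNorm E lam α θ L with hR
  have hR0 : 0 ≤ R := Real.sqrt_nonneg _
  have hcube : ((B ^ ζ) ^ k) ^ 3 ≤ (c * R) ^ 3 := by
    calc ((B ^ ζ) ^ k) ^ 3 = ((B ^ ζ) ^ 3) ^ k := by rw [← pow_mul, ← pow_mul, mul_comm]
      _ ≤ xi lam ^ k := pow_le_pow_left₀ (by positivity) hζB k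
      _ ≤ xi lam * (8 * κ ^ 3 * R ^ 3) := hder.trans (mul_le_mul_of_nonneg_left hbound (by linarith))
      _ = (8 * xi lam) * (κ ^ 3 * R ^ 3) := by ring
      _ ≤ (8 * xi lam) ^ 3 * (κ ^ 3 * R ^ 3) := by
          gcongr
          exact le_self_pow₀ (by linarith) (by norm_num)
      _ = (c * R) ^ 3 := by rw [hc]; ring
  have hroot : (B ^ ζ) ^ k ≤ c * R := le_of_pow_le_pow_left₀ (by norm_num) (by positivity) hcube
  have hLζ : |L| ^ ζ ≤ (B ^ ζ) ^ (k + 4) := by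
    refine (Real.rpow_le_rpow (abs_nonneg L) hn2.le hζ.le).trans_eq ?_
    rw [← Real.rpow_natCast, ← Real.rpow_natCast, ← Real.rpow_mul (by linarith),
      ← Real.rpow_mul (by linarith), mul_comm]
  rw [one_div, inv_mul_le_iff₀ (by positivity)]
  calc |L| ^ ζ ≤ (B ^ ζ) ^ 4 * (B ^ ζ) ^ k := by rw [← pow_add, add_comm]; exact hLζ
    _ ≤ (B ^ ζ) ^ 4 * (c * R) := by gcongr
    _ = _ := by ring

end

end Sturmian

theorem mainTheorem2 (lam α : ℝ) (hlam : 20 < lam) (hα : α ∈ Sturmian.classE) :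
    (∃ C : ℝ, 0 < C ∧ ∃ ζ : ℝ, 0 < ζ ∧ Sturmian.PowerLawBound lam α C ζ) ∧
    (∀ B : ℝ, Sturmian.IsGrowthBound α B →
      0 < Real.log (Sturmian.xi lam) / (3 * Real.log B) ∧
      ∀ ζ : ℝ, 0 < ζ → ζ ≤ Real.log (Sturmian.xi lam) / (3 * Real.log B) →
        ∃ C : ℝ, 0 < C ∧ Sturmian.PowerLawBound lam α C ζ) := by
  obtain ⟨hα01, hirr, B₀, hB₀⟩ := hα
  have hξ := Sturmian.two_lt_xi hlam
  have hpos : ∀ B : ℝ, Sturmian.IsGrowthBound α B →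
      0 < Real.log (Sturmian.xi lam) / (3 * Real.log B) := fun B hB => by
    have := Real.log_pos (show 1 < B by linarith [hB.two_le hα01 hirr])
    have := Real.log_pos (show 1 < Sturmian.xi lam by linarith)
    positivity
  have hmain : ∀ B : ℝ, Sturmian.IsGrowthBound α B → ∀ ζ : ℝ, 0 < ζ →
      ζ ≤ Real.log (Sturmian.xi lam) / (3 * Real.log B) →
      ∃ C : ℝ, 0 < C ∧ Sturmian.PowerLawBound lam α C ζ := fun B hB ζ hζ hle => by
    have hB2 := hB.two_le hα01 hirr
    have hlog := Real.log_pos (show 1 < B by linarith)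
    refine Sturmian.powerLawBound_of_rpow_le hlam hα01 hirr hB hζ ?_
    rw [le_div_iff₀ (by positivity)] at hle
    have hβ : 0 < B ^ ζ := Real.rpow_pos_of_pos (by linarith) _
    rw [← Real.log_le_log_iff (by positivity) (by linarith), Real.log_pow,
      Real.log_rpow (by linarith)]
    push_cast
    linarith
  refine ⟨?_, fun B hB => ⟨hpos B hB, hmain B hB⟩⟩
  obtain ⟨C, hC, h⟩ := hmain B₀ hB₀ _ (hpos B₀ hB₀) le_rfl
  exact ⟨C, hC, _, hpos B₀ hB₀, h⟩
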